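/- All graphs are finite and simple. Given a graph $G$ and $A\subseteq V(G)$, an $A$-path is a path of length at least $1$ whose first and last vertex, but no interior vertex, lie in $A$; for $B\subseteq V(G)$, an $A$--$B$--$A$-path is an $A$-path that contains a vertex of $B$; an $A$-path is even (odd) if it has an even (odd) number of edges. Let $\Gamma$ be an abelian group and let every edge $e$ of $G$ carry a label $\gamma(e)\in\Gamma$. In the undirected setting, an $A$-path is zero if the sum of the labels of its edges is $0$. In the directed setting, every edge also has a reference orientation, and $e$ is counted with weight $\gamma(e)$ if the path traverses it in the direction of its orientation and with weight $-\gamma(e)$ otherwise; an $A$-path is zero if the sum of these weights is $0$. A class of target paths has the edge-Erdős–Pósa property if for every integer $k$ there is a number $f(k)$ such that every graph (with every choice of the additional data $A$, $B$, labels, orientation that the class refers to) contains $k$ pairwise edge-disjoint target paths or a set of at most $f(k)$ edges that meets every target path. Theorem. (1) None of the following classes has the edge-Erdős–Pósa property: $A$--$B$--$A$-paths; even $A$-paths; odd $A$-paths; for every non-trivial abelian group $\Gamma$, zero $A$-paths with respect to undirected $\Gamma$-labellings; for every non-trivial abelian group $\Gamma$, zero $A$-paths with respect to directed $\Gamma$-labellings.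 (2) More precisely, let $r\ge 1$ and $n=10r$. Let $W$ be the wall with $n\times n$ bricks whose vertices are the points $(x,j)$ with $0\le x\le 2n+1$ and $0\le j\le n$ other than $(0,0)$ and $(2n+1,n)$, and whose edges are all $(x,j)(x+1,j)$, and all $(x,j)(x,j+1)$ with $x+j$ odd. Add two vertices $a_1,a_2$, put $A=\{a_1,a_2\}$, link $a_1$ to every vertex of $W$ in column $0$ and $a_2$ to every vertex of $W$ in column $2n+1$, where each link is a single edge or a path of length two. Then in each of the following graphs no two target paths are edge-disjoint, but every set of edges that meets all target paths has at least $r$ elements: (a) all links are single edges, $B$ is the top row $\{(x,j)\in V(W): j=n\}$, and the target paths are the $A$--$B$--$A$-paths; (b) the links at the vertices $(x,j)$ with $x+j$ odd have length two and all other links are single edges, the grey edges $(4i+1,n)(4i+3,n)$, $0\le i<5r$, are added, and the target paths are the odd $A$-paths; (c) the links of $a_1$ at vertices $(x,j)$ with $x+j$ odd and the links of $a_2$ at vertices $(x,j)$ with $x+j$ even have length two, all other links are single edges, the same grey edges are added, and the target paths are the even $A$-paths; (d) the graph of (b), where for an abelian group $\Gamma$ and $0\ne\mu\in\Gamma$ all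 edges incident with $a_1$ are labelled $\mu$, all grey edges are labelled $-\mu$ and all other edges $0$, and the target paths are the zero $A$-paths, either in the undirected setting, or in the directed setting with all edges oriented from left to right and from top to bottom. -/

import Mathlib

universe u w

/-! ## Target paths, packings and hitting sets

All graphs are simple. A path is a walk `p` with `p.IsPath`; a walk and its reverse have the
same edges, so describing paths as walks does not affect packings or hitting sets. -/

section Paths

variable {V : Type u} {G : SimpleGraph V}

/-- `p` is an `A`-path: a path (of length at least one) whose first and last vertex, but no
interior vertex, lie in `A`. -/
def IsAPath (A : Set V) {s t : V} (p : G.Walk s t) : Prop :=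
  p.IsPath ∧ s ≠ t ∧ s ∈ A ∧ t ∈ A ∧ ∀ v ∈ p.support, v ∈ A → v = s ∨ v = t

/-- `p` is an `A`--`B`--`A`-path: an `A`-path that meets some vertex of `B`. -/
def IsABAPath (A B : Set V) {s t : V} (p : G.Walk s t) : Prop :=
  IsAPath A p ∧ ∃ v ∈ p.support, v ∈ B

/-- An `A`-path of even length. -/
def IsEvenAPath (A : Set V) {s t : V} (p : G.Walk s t) : Prop :=
  IsAPath A p ∧ Even p.length

/-- An `A`-path of odd length. -/
def IsOddAPath (A : Set V) {s t : V} (p : G.Walk s t) : Prop :=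
  IsAPath A p ∧ Odd p.length

/-- A zero `A`-path for the undirected edge labelling `γ` (only the values of `γ` on edges of
the graph matter): the sum of the labels of its edges is zero. -/
def IsUndirectedZeroAPath {Γ : Type w} [AddCommGroup Γ] (A : Set V) (γ : Sym2 V → Γ)
    {s t : V} (p : G.Walk s t) : Prop :=
  IsAPath A p ∧ (p.edges.map γ).sum = 0

/-- A directed labelling of `G`: a reference orientation of every edge (the edge `uv` is
oriented from `u` to `v` if `dir u v`) together with a label for every edge. -/
structure DirectedLabelling (G : SimpleGraph V) (Γ : Type w) where
  dir : V → V → Prop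
  dir_xor : ∀ a b, G.Adj a b → Xor (dir a b) (dir b a)
  label : Sym2 V → Γ

open Classical in
/-- The weight with which an edge is counted when it is traversed as the dart `d`. -/
noncomputable def DirectedLabelling.weight {Γ : Type w} [AddCommGroup Γ]
    (L : DirectedLabelling G Γ) (d : G.Dart) : Γ :=
  if L.dir d.fst d.snd then L.label d.edge else -L.label d.edge

/-- A zero `A`-path for a directed labelling. -/
def IsDirectedZeroAPath {Γ : Type w} [AddCommGroup Γ] (A : Set V) (L : DirectedLabelling G Γ)
    {s t : V} (p : G.Walk s t) : Prop :=
  IsAPath A p ∧ (p.darts.map L.weight).sum = 0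

/-- There are `k` pairwise edge-disjoint walks in the family `T`. -/
def HasEdgeDisjoint (T : ∀ ⦃s t : V⦄, G.Walk s t → Prop) (k : ℕ) : Prop :=
  ∃ (s t : Fin k → V) (P : ∀ i, G.Walk (s i) (t i)),
    (∀ i, T (P i)) ∧ ∀ i j, i ≠ j → List.Disjoint (P i).edges (P j).edges

/-- `Z` is a set of edges of `G` that meets every walk in the family `T`. -/
def IsEdgeHittingSet (T : ∀ ⦃s t : V⦄, G.Walk s t → Prop) (Z : Finset (Sym2 V)) : Prop :=
  (∀ e ∈ Z, e ∈ G.edgeSet) ∧ ∀ ⦃s t : V⦄ (p : G.Walk s t), T p → ∃ e ∈ p.edges, e ∈ Z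

/-- No two members of `T` are edge-disjoint, and no set of fewer than `r` edges meets all
members of `T`. -/
def IsEdgeCounterexample (T : ∀ ⦃s t : V⦄, G.Walk s t → Prop) (r : ℕ) : Prop :=
  ¬ HasEdgeDisjoint T 2 ∧ ∀ Z : Finset (Sym2 V), IsEdgeHittingSet T Z → r ≤ Z.card

end Paths

/-- The edge-Erdős--Pósa property of a class of target paths. Here `S V G` is the type of extra
data (vertex sets, labellings) that a graph `G` on `V` is equipped with, and `T G σ` is the
family of target paths of `G` with respect to the data `σ`. -/
def HasEdgeErdosPosaProperty (S : ∀ V : Type, SimpleGraph V → Type w)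
    (T : ∀ {V : Type} (G : SimpleGraph V), S V G → ∀ ⦃s t : V⦄, G.Walk s t → Prop) : Prop :=
  ∃ f : ℕ → ℕ, ∀ (k : ℕ) (V : Type) [Finite V] (G : SimpleGraph V) (σ : S V G),
    HasEdgeDisjoint (T G σ) k ∨
      ∃ Z : Finset (Sym2 V), Z.card ≤ f k ∧ IsEdgeHittingSet (T G σ) Z

/-- `A`--`B`--`A`-paths have the edge-Erdős--Pósa property. -/
def ABAPathsEdgeErdosPosa : Prop :=
  HasEdgeErdosPosaProperty (fun V _ => Set V × Set V)
    (fun _ σ _ _ p => IsABAPath σ.1 σ.2 p)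

/-- Even `A`-paths have the edge-Erdős--Pósa property. -/
def EvenAPathsEdgeErdosPosa : Prop :=
  HasEdgeErdosPosaProperty (fun V _ => Set V) (fun _ A _ _ p => IsEvenAPath A p)

/-- Odd `A`-paths have the edge-Erdős--Pósa property. -/
def OddAPathsEdgeErdosPosa : Prop :=
  HasEdgeErdosPosaProperty (fun V _ => Set V) (fun _ A _ _ p => IsOddAPath A p)

/-- Zero `A`-paths with respect to undirected `Γ`-labellings have the edge-Erdős--Pósa
property. -/
def UndirectedZeroAPathsEdgeErdosPosa (Γ : Type w) [AddCommGroup Γ] : Prop :=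
  HasEdgeErdosPosaProperty (fun V _ => Set V × (Sym2 V → Γ))
    (fun _ σ _ _ p => IsUndirectedZeroAPath σ.1 σ.2 p)

/-- Zero `A`-paths with respect to directed `Γ`-labellings have the edge-Erdős--Pósa
property. -/
def DirectedZeroAPathsEdgeErdosPosa (Γ : Type w) [AddCommGroup Γ] : Prop :=
  HasEdgeErdosPosaProperty (fun V G => Set V × DirectedLabelling G Γ)
    (fun _ σ _ _ p => IsDirectedZeroAPath σ.1 σ.2 p)

/-! ## The wall and the counterexamples -/

/-- The vertices of the wall with `n × n` bricks, as pairs (column, row), rows being counted from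
the bottom: all points with column in `{0, …, 2n+1}` and row in `{0, …, n}`, except for the two
corner points that would have degree one. -/
def WallVertex (n : ℕ) : Type :=
  {p : ℕ × ℕ // p.1 ≤ 2 * n + 1 ∧ p.2 ≤ n ∧ p ≠ (0, 0) ∧
    p ≠ (if Even n then (2 * n + 1, n) else (0, n))}

namespace WallVertex

variable {n : ℕ}

def col (v : WallVertex n) : ℕ := v.1.1

def row (v : WallVertex n) : ℕ := v.1.2

/-- `v` is the left neighbour of `v'` in a horizontal row. -/
def LeftOf (v v' : WallVertex n) : Prop := v.row = v'.row ∧ v.col + 1 = v'.col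

/-- `v` is the upper end and `v'` the lower end of a vertical edge of the wall; the vertical edges
are those between `(x, j)` and `(x, j + 1)` with `x + j` odd. -/
def Above (v v' : WallVertex n) : Prop :=
  v.col = v'.col ∧ v'.row + 1 = v.row ∧ Odd (v'.col + v'.row)

/-- `v` and `v'` are the left and right end of a grey edge: the points `(4i + 1, n)` and
`(4i + 3, n)` of the top row (for even `n`). -/
def GreyPair (v v' : WallVertex n) : Prop :=
  v.row = n ∧ v'.row = n ∧ v.col % 4 = 1 ∧ v'.col = v.col + 2

def OnLeftSide (v : WallVertex n) : Prop := v.col = 0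

def OnRightSide (v : WallVertex n) : Prop := v.col = 2 * n + 1

def OnTop (v : WallVertex n) : Prop := v.row = n

end WallVertex

/-- Vertices of the linked wall: the left and the right `A`-vertex, the wall vertices, and one
subdividing vertex `mid v` for every vertex `v` on the left or right side of the wall whose link
to the corresponding `A`-vertex is subdivided (those with `sub v`). -/
inductive LinkedWallVertex (n : ℕ) (sub : WallVertex n → Prop) : Type
  | left : LinkedWallVertex n sub
  | right : LinkedWallVertex n sub
  | wall (v : WallVertex n) : LinkedWallVertex n sub
  | mid (v : WallVertex n) (side : v.OnLeftSide ∨ v.OnRightSide) (h : sub v) :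
      LinkedWallVertex n sub

open LinkedWallVertex in
/-- The edges of the linked wall, oriented from left to right and from top to bottom: the edges of
the wall; if `grey` holds, the grey edges; and for every vertex `v` on the left (right) side of the
wall a link to the left (right) `A`-vertex, which is a path of length two if `sub v` and a single
edge otherwise. -/
inductive LinkedWallArc (n : ℕ) (sub : WallVertex n → Prop) (grey : Prop) :
    LinkedWallVertex n sub → LinkedWallVertex n sub → Prop
  | horizontal (v v' : WallVertex n) (h : v.LeftOf v') :
      LinkedWallArc n sub grey (wall v) (wall v')
  | vertical (v v' : WallVertex n) (h : v.Above v') :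
      LinkedWallArc n sub grey (wall v) (wall v')
  | greyEdge (v v' : WallVertex n) (hg : grey) (h : v.GreyPair v') :
      LinkedWallArc n sub grey (wall v) (wall v')
  | leftLink (v : WallVertex n) (h : v.OnLeftSide) (hs : ¬ sub v) :
      LinkedWallArc n sub grey left (wall v)
  | leftLinkOuter (v : WallVertex n) (h : v.OnLeftSide) (hs : sub v) :
      LinkedWallArc n sub grey left (mid v (Or.inl h) hs)
  | leftLinkInner (v : WallVertex n) (h : v.OnLeftSide) (hs : sub v) :
      LinkedWallArc n sub grey (mid v (Or.inl h) hs) (wall v)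
  | rightLink (v : WallVertex n) (h : v.OnRightSide) (hs : ¬ sub v) :
      LinkedWallArc n sub grey (wall v) right
  | rightLinkInner (v : WallVertex n) (h : v.OnRightSide) (hs : sub v) :
      LinkedWallArc n sub grey (wall v) (mid v (Or.inr h) hs)
  | rightLinkOuter (v : WallVertex n) (h : v.OnRightSide) (hs : sub v) :
      LinkedWallArc n sub grey (mid v (Or.inr h) hs) right

/-- The wall with `n × n` bricks together with the two `A`-vertices linked to its sides. -/
def linkedWall (n : ℕ) (sub : WallVertex n → Prop) (grey : Prop) :
    SimpleGraph (LinkedWallVertex n sub) :=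
  SimpleGraph.fromRel (LinkedWallArc n sub grey)

/-- The vertex set `A`, consisting of the left and the right `A`-vertex. -/
def linkedWallA (n : ℕ) (sub : WallVertex n → Prop) : Set (LinkedWallVertex n sub) :=
  {LinkedWallVertex.left, LinkedWallVertex.right}

/-- The vertex set `B`, the top row of the wall. -/
def linkedWallB (n : ℕ) (sub : WallVertex n → Prop) : Set (LinkedWallVertex n sub) :=
  {x | ∃ v : WallVertex n, v.OnTop ∧ x = LinkedWallVertex.wall v}

/-- No link is subdivided. -/
def noSub (n : ℕ) (_ : WallVertex n) : Prop := False

/-- On both sides the links at the vertices `(x, j)` with `x + j` odd are subdivided; then all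
`A`-paths without grey edges have even length. -/
def oddSub (n : ℕ) (v : WallVertex n) : Prop := Odd (v.col + v.row)

/-- On the left side the links at vertices `(x, j)` with `x + j` odd are subdivided, and on the
right side those with `x + j` even; then all `A`-paths without grey edges have odd length. -/
def evenSub (n : ℕ) (v : WallVertex n) : Prop :=
  (v.OnLeftSide ∧ Odd (v.col + v.row)) ∨ (v.OnRightSide ∧ Even (v.col + v.row))

/-- The wall without grey edges in which the `A`--`B`--`A`-paths are considered. -/
def abaWall (n : ℕ) : SimpleGraph (LinkedWallVertex n (noSub n)) := linkedWall n (noSub n) False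

/-- The wall with grey edges for odd `A`-paths, also used for zero `A`-paths. -/
def oddWall (n : ℕ) : SimpleGraph (LinkedWallVertex n (oddSub n)) := linkedWall n (oddSub n) True

/-- The wall with grey edges for even `A`-paths. -/
def evenWall (n : ℕ) : SimpleGraph (LinkedWallVertex n (evenSub n)) :=
  linkedWall n (evenSub n) True

open Classical in
/-- The labelling of `oddWall n`: edges at the left `A`-vertex get `μ`, grey edges get `-μ`, all
other edges get `0`. -/
noncomputable def zeroWallLabel (n : ℕ) {Γ : Type w} [AddCommGroup Γ] (μ : Γ)
    (e : Sym2 (LinkedWallVertex n (oddSub n))) : Γ :=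
  if LinkedWallVertex.left ∈ e then μ
  else if ∃ v v' : WallVertex n, v.GreyPair v' ∧
      e = s(LinkedWallVertex.wall v, LinkedWallVertex.wall v') then -μ
  else 0

theorem LinkedWallArc.asymm {n : ℕ} {sub : WallVertex n → Prop} {grey : Prop}
    {a b : LinkedWallVertex n sub} (h : LinkedWallArc n sub grey a b) :
    ¬ LinkedWallArc n sub grey b a := by
  intro h'
  cases h with
  | horizontal v v' h =>
    obtain ⟨h1, h2⟩ := h
    cases h' with
    | horizontal _ _ h => obtain ⟨h3, h4⟩ := h; omega
    | vertical _ _ h => obtain ⟨h3, h4, h5⟩ := h; omega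
    | greyEdge _ _ _ h => obtain ⟨h3, h4, h5, h6⟩ := h; omega
  | vertical v v' h =>
    obtain ⟨h1, h2, -⟩ := h
    cases h' with
    | horizontal _ _ h => obtain ⟨h3, h4⟩ := h; omega
    | vertical _ _ h => obtain ⟨h3, h4, h5⟩ := h; omega
    | greyEdge _ _ _ h => obtain ⟨h3, h4, h5, h6⟩ := h; omega
  | greyEdge v v' _ h =>
    obtain ⟨h1, h2, -, h0⟩ := h
    cases h' with
    | horizontal _ _ h => obtain ⟨h3, h4⟩ := h; omega
    | vertical _ _ h => obtain ⟨h3, h4, h5⟩ := h; omega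
    | greyEdge _ _ _ h => obtain ⟨h3, h4, h5, h6⟩ := h; omega
  | leftLink v h hs => cases h'
  | leftLinkOuter v h hs => cases h'
  | leftLinkInner v h hs =>
    cases h' with
    | rightLinkInner _ h'' _ =>
      simp only [WallVertex.OnLeftSide, WallVertex.OnRightSide] at h h''; omega
  | rightLink v h hs => cases h'
  | rightLinkInner v h hs =>
    cases h' with
    | leftLinkInner _ h'' _ =>
      simp only [WallVertex.OnLeftSide, WallVertex.OnRightSide] at h h''; omega
  | rightLinkOuter v h hs => cases h'

/-- The directed labelling of `oddWall n`: the labels are those of `zeroWallLabel`, and all edges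
are oriented from left to right and from top to bottom. -/
noncomputable def zeroWallDirectedLabelling (n : ℕ) {Γ : Type w} [AddCommGroup Γ] (μ : Γ) :
    DirectedLabelling (oddWall n) Γ where
  dir := LinkedWallArc n (oddSub n) True
  dir_xor := by
    intro a b hab
    rcases hab.2 with h | h
    · exact Or.inl ⟨h, h.asymm⟩
    · exact Or.inr ⟨h, h.asymm⟩
  label := zeroWallLabel n μ

/-! Each of the graphs is a counterexample for two reasons.

No two target paths are edge-disjoint. Every target path meets the top row: for `A`--`B`--`A`-paths
by definition, otherwise because an `A`-path without grey edges has the wrong parity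
(`even_length_add_color`) or a non-zero total `μ` or `-μ`, and grey edges end in the top row. Wall
vertices have at most three neighbours, so edge-disjoint `A`-paths share no wall vertex. Rerouting
each grey edge through the top vertex below it turns the paths into disjoint connected sets of grid
points. Each path links its top vertex to both sides of the grid. The path whose top vertex is
further right cuts off, on its way to the left side, the other top vertex from the right side
(`grid_crossing`); a signed crossing count replaces the Jordan curve theorem.

Few edges do not meet all target paths. Fewer than `r` edges miss some odd row with its links and
some block of four columns. Inside these, one path climbs from the left `A`-vertex to the top in the
left half of the block, and a disjoint one descends to the right `A`-vertex in the right half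
(`exists_two_paths`). One top edge joins them: a horizontal edge for `A`--`B`--`A`-paths, and
otherwise a grey edge, which flips the parity or cancels `μ`. -/

/-! ## Crossing paths in a rectangular grid -/

/-- Two points of the integer grid are neighbours. -/
def GridAdj (p q : ℕ × ℕ) : Prop :=
  (p.1 = q.1 ∧ (p.2 + 1 = q.2 ∨ q.2 + 1 = p.2)) ∨ (p.2 = q.2 ∧ (p.1 + 1 = q.1 ∨ q.1 + 1 = p.1))

/-- A grid step inside the set `S`. -/
def GridStep (S : Set (ℕ × ℕ)) (p q : ℕ × ℕ) : Prop := GridAdj p q ∧ p ∈ S ∧ q ∈ S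

theorem GridStep.symm {S : Set (ℕ × ℕ)} {p q : ℕ × ℕ} (h : GridStep S p q) : GridStep S q p := by
  obtain ⟨h, hp, hq⟩ := h
  refine ⟨?_, hq, hp⟩
  unfold GridAdj at *
  omega

theorem GridStep.reflTransGen_symm {S : Set (ℕ × ℕ)} {p q : ℕ × ℕ}
    (h : Relation.ReflTransGen (GridStep S) p q) : Relation.ReflTransGen (GridStep S) q p := by
  have : Std.Symm (GridStep S) := ⟨fun _ _ h => h.symm⟩
  exact symm_of (Relation.ReflTransGen (GridStep S)) h

open Classical in
/-- A grid walk in `S` from `s` to `t` has a signed count `C x y` of its horizontal edges between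
the columns `x - 1` and `x` in rows at least `y`. It changes between neighbouring points outside
`S` only above the ends of the walk. -/
theorem exists_crossingCount {S : Set (ℕ × ℕ)} {M N : ℕ} (hS : ∀ p ∈ S, p.1 ≤ M ∧ p.2 ≤ N)
    {s t : ℕ × ℕ} (h : Relation.ReflTransGen (GridStep S) s t) :
    ∃ C : ℕ → ℕ → ℤ,
      (∀ x y, (x, y) ∉ S → C x y = C x (y + 1)) ∧
      (∀ x y, (x, y) ∉ S → C x y + (if s.1 = x ∧ y ≤ s.2 then 1 else 0) =
        C (x + 1) y + (if t.1 = x ∧ y ≤ t.2 then 1 else 0)) ∧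
      (∀ x y, M < x → C x y = 0) ∧ (∀ x y, N < y → C x y = 0) := by
  induction h with
  | refl => exact ⟨fun _ _ => 0, by simp⟩
  | @tail b c _ hbc ih =>
    obtain ⟨C, h1, h2, h3, h4⟩ := ih
    obtain ⟨hadj, hb, hc⟩ := hbc
    obtain ⟨b1, b2⟩ := b
    obtain ⟨c1, c2⟩ := c
    have hb' := hS _ hb
    have hc' := hS _ hc
    have key : ∀ x y, (x, y) ∉ S → ¬ (x = b1 ∧ y = b2) ∧ ¬ (x = c1 ∧ y = c2) := by
      intro x y hxy
      constructor
      · rintro ⟨rfl, rfl⟩; exact hxy hb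
      · rintro ⟨rfl, rfl⟩; exact hxy hc
    simp only [GridAdj] at hadj hb' hc'
    -- A horizontal step counts `1` or `-1` at the column of its right end, for all `y` up to its
    -- row; a vertical step counts nothing. The second property is conservation of flow on the ray
    -- above `(x, y)`: a vertical step can leave this ray only through `(x, y)`, which is not in
    -- `S`.
    refine ⟨fun x y => C x y + if b2 = c2 ∧ y ≤ b2 then
      (if b1 + 1 = x ∧ c1 = x then 1 else if c1 + 1 = x ∧ b1 = x then -1 else 0) else 0,
      ?_, ?_, ?_, ?_⟩
    · intro x y hxy
      have := key x y hxy
      simp only [h1 x y hxy]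
      split_ifs <;> omega
    · intro x y hxy
      have := key x y hxy
      have h2' := h2 x y hxy
      simp only at h2' ⊢
      generalize (if s.1 = x ∧ y ≤ s.2 then (1 : ℤ) else 0) = D at h2' ⊢
      split_ifs at h2' ⊢ <;> omega
    · intro x y hxy
      simp only [h3 x y hxy]
      split_ifs <;> omega
    · intro x y hxy
      simp only [h4 x y hxy]
      split_ifs <;> omega

/-- In a rectangular grid, a walk from the left side to the top side meets every walk to the right
side that starts further left on the top side. -/
theorem grid_crossing {S T : Set (ℕ × ℕ)} {M N : ℕ} (hST : Disjoint S T)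
    (hS : ∀ p ∈ S, p.1 ≤ M ∧ p.2 ≤ N) (hT : ∀ p ∈ T, p.1 ≤ M ∧ p.2 ≤ N) {s t x z : ℕ × ℕ}
    (hs0 : s.1 = 0) (htN : t.2 = N) (hxN : x.2 = N) (hzM : z.1 = M) (hxt : x.1 ≤ t.1)
    (hs : s ∈ S) (ht : t ∈ S) (hx : x ∈ T)
    (hst : Relation.ReflTransGen (GridStep S) s t)
    (hxz : Relation.ReflTransGen (GridStep T) x z) : False := by
  classical
  obtain ⟨C, h1, h2, h3, h4⟩ := exists_crossingCount hS hst
  obtain ⟨s1, s2⟩ := s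
  obtain ⟨t1, t2⟩ := t
  simp only at hs0 htN hxt
  subst hs0 htN
  have hdis : ∀ p ∈ T, p ∉ S := fun p hp hp' => Set.disjoint_left.1 hST hp' hp
  have hs2 := hS _ hs
  simp only at h2 hs2
  have ht2 := hS _ ht
  simp only at ht2
  -- the invariant along the second walk
  let F : ℕ → ℕ → ℤ := fun a b => C a b - (if a ≤ t1 then 1 else 0) +
    (if a = 0 ∧ b ≤ s2 then 1 else 0)
  have hz : z ∈ T := by
    rcases Relation.ReflTransGen.cases_tail hxz with h | ⟨c, -, h⟩
    · exact h ▸ hx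
    · exact h.2.2
  -- The corrections in `F` absorb the end terms of `h2`. As `t` lies in the top row, its term is
  -- present for every `b` in the grid, hence the condition `a ≤ t1` alone.
  have right : ∀ a b, (a, b) ∈ T → F a b = F (a + 1) b := by
    intro a b hab
    have := h2 a b (hdis _ hab)
    have hb := (hT _ hab).2
    simp only at hb
    have hne : ¬ (a + 1 = 0 ∧ b ≤ s2) := by omega
    change C a b - (if a ≤ t1 then 1 else 0) + (if a = 0 ∧ b ≤ s2 then 1 else 0) =
      C (a + 1) b - (if a + 1 ≤ t1 then 1 else 0) + (if a + 1 = 0 ∧ b ≤ s2 then 1 else 0)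
    rw [if_neg hne]
    split_ifs at this ⊢ <;> omega
  -- The only correction depending on `b` jumps at `s`, which is not in `T`.
  have up : ∀ a b, (a, b) ∈ T → F a b = F a (b + 1) := by
    intro a b hab
    have := h1 a b (hdis _ hab)
    have hne : ¬ (a = 0 ∧ b = s2) := by
      rintro ⟨rfl, rfl⟩; exact hdis _ hab hs
    simp only [F]
    split_ifs at this ⊢ <;> omega
  have hconst : F x.1 x.2 = F z.1 z.2 := by
    clear hz hzM
    induction hxz with
    | refl => rfl
    | @tail b c _ hbc ih =>
      obtain ⟨hadj, hb, hc⟩ := hbc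
      obtain ⟨b1, b2⟩ := b
      obtain ⟨c1, c2⟩ := c
      simp only [GridAdj] at hadj
      rw [ih]
      rcases hadj with ⟨rfl, rfl | rfl⟩ | ⟨rfl, rfl | rfl⟩
      · exact up _ _ hb
      · exact (up _ _ hc).symm
      · exact right _ _ hb
      · exact (right _ _ hc).symm
  -- One column beyond the right side, the count and both corrections vanish.
  have hend : F z.1 z.2 = 0 := by
    rw [right _ _ hz]
    have hne : ¬ (z.1 + 1 = 0 ∧ z.2 ≤ s2) := by omega
    change C (z.1 + 1) z.2 - (if z.1 + 1 ≤ t1 then 1 else 0) +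
      (if z.1 + 1 = 0 ∧ z.2 ≤ s2 then 1 else 0) = 0
    rw [if_neg hne, if_neg (by omega), h3 _ _ (by omega)]
    rfl
  -- One row above the top, only the correction for `x.1 ≤ t1` survives.
  have hstart : F x.1 x.2 = -1 := by
    have hx' : (x.1, x.2) ∈ T := hx
    rw [up _ _ hx']
    simp only [F, hxN, h4 _ (t2 + 1) (by omega)]
    split_ifs <;> omega
  omega

/-! ## Paths -/

namespace SimpleGraph.Walk

variable {V : Type u} {G : SimpleGraph V}

/-- A path traverses two edges at each of its interior vertices. -/
theorem IsPath.exists_two_edges {s t v : V} {p : G.Walk s t} (hp : p.IsPath) (hv : v ∈ p.support)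
    (hs : v ≠ s) (ht : v ≠ t) : ∃ x y, x ≠ y ∧ s(v, x) ∈ p.edges ∧ s(v, y) ∈ p.edges := by
  induction p with
  | nil => simp at hv; exact absurd hv hs
  | @cons a b c h q ih =>
    rw [cons_isPath_iff] at hp
    rw [support_cons, List.mem_cons] at hv
    have hv := hv.resolve_left hs
    by_cases hvb : v = b
    · subst hvb
      cases q with
      | nil => exact absurd rfl ht
      | @cons _ d _ h' q' =>
        refine ⟨a, d, ?_, by simp [Sym2.eq_swap], by simp⟩
        rintro rfl
        exact hp.2 (by simp)
    · obtain ⟨x, y, hxy, hx, hy⟩ := ih hp.1 hv hvb ht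
      exact ⟨x, y, hxy, by simp [hx], by simp [hy]⟩

/-- Two paths with disjoint supports, joined by an edge. -/
theorem IsPath.append_cons {a b c d : V} {p : G.Walk a b} {q : G.Walk c d} (hp : p.IsPath)
    (hq : q.IsPath) (h : G.Adj b c) (hd : ∀ v ∈ p.support, v ∉ q.support) :
    (p.append (cons h q)).IsPath := by
  rw [isPath_def, support_append, List.nodup_append]
  refine ⟨hp.support_nodup, by simpa using hq.support_nodup, ?_⟩
  intro x hx y hy hxy
  simp only [support_cons, List.tail_cons] at hy
  exact hd x hx (hxy ▸ hy)

end SimpleGraph.Walk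

/-! ## Geometry of the linked wall -/

theorem WallVertex.ext {n : ℕ} {v w : WallVertex n} (hc : v.col = w.col) (hr : v.row = w.row) :
    v = w :=
  Subtype.ext (Prod.ext hc hr)

namespace LinkedWallVertex

variable {n : ℕ} {sub : WallVertex n → Prop}

/-- The position of a vertex in the grid; subdividing vertices get the position of the wall vertex
that they are attached to, and the `A`-vertices are only placed in the correct column. -/
def pos : LinkedWallVertex n sub → ℕ × ℕ
  | left => (0, 0)
  | right => (2 * n + 1, 0)
  | wall v => v.1
  | mid v _ _ => v.1

/-- `x` is the neighbour of the wall vertex `v` on its left. -/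
def IsLeftNeighbor (v : WallVertex n) (x : LinkedWallVertex n sub) : Prop :=
  (∃ v', x = wall v' ∧ v'.LeftOf v) ∨ (v.OnLeftSide ∧ ¬ sub v ∧ x = left) ∨
    (v.OnLeftSide ∧ ∃ h hs, x = mid v h hs)

/-- `x` is the neighbour of the wall vertex `v` on its right. -/
def IsRightNeighbor (v : WallVertex n) (x : LinkedWallVertex n sub) : Prop :=
  (∃ v', x = wall v' ∧ v.LeftOf v') ∨ (v.OnRightSide ∧ ¬ sub v ∧ x = right) ∨
    (v.OnRightSide ∧ ∃ h hs, x = mid v h hs)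

/-- `x` is joined to the wall vertex `v` by a vertical or a grey edge. -/
def IsThirdNeighbor (v : WallVertex n) (x : LinkedWallVertex n sub) : Prop :=
  ∃ v', x = wall v' ∧ (v.Above v' ∨ v'.Above v ∨ v.GreyPair v' ∨ v'.GreyPair v)

theorem IsLeftNeighbor.unique {v : WallVertex n} {x y : LinkedWallVertex n sub}
    (hx : IsLeftNeighbor v x) (hy : IsLeftNeighbor v y) : x = y := by
  rcases hx with ⟨a, rfl, ha, ha'⟩ | ⟨h, hs, rfl⟩ | ⟨h, _, hs, rfl⟩ <;>
  rcases hy with ⟨b, rfl, hb, hb'⟩ | ⟨h', hs', rfl⟩ | ⟨h', _, hs', rfl⟩ <;>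
  try unfold WallVertex.OnLeftSide at h
  all_goals try unfold WallVertex.OnLeftSide at h'
  · rw [WallVertex.ext (v := a) (w := b) (by omega) (by omega)]
  all_goals first | omega | rfl | exact absurd hs hs' | exact absurd hs' hs

theorem IsRightNeighbor.unique {v : WallVertex n} {x y : LinkedWallVertex n sub}
    (hx : IsRightNeighbor v x) (hy : IsRightNeighbor v y) : x = y := by
  have bound : ∀ a : WallVertex n, a.col ≤ 2 * n + 1 := fun a => a.2.1
  rcases hx with ⟨a, rfl, ha, ha'⟩ | ⟨h, hs, rfl⟩ | ⟨h, _, hs, rfl⟩ <;>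
  rcases hy with ⟨b, rfl, hb, hb'⟩ | ⟨h', hs', rfl⟩ | ⟨h', _, hs', rfl⟩ <;>
  try unfold WallVertex.OnRightSide at h
  all_goals try unfold WallVertex.OnRightSide at h'
  all_goals try have := bound a
  all_goals try have := bound b
  · rw [WallVertex.ext (v := a) (w := b) (by omega) (by omega)]
  all_goals first | omega | rfl | exact absurd hs hs' | exact absurd hs' hs

/-- The parity of column plus row decides whether the vertical edge at `v` goes up or down. A grey
edge ends in the top row at an odd column; as `n` is even, the vertical edge there would have to go
up, so there is none. With the two preceding lemmas and `neighbor_cases`, wall vertices have degree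
at most three. -/
theorem IsThirdNeighbor.unique (hn : Even n) {v : WallVertex n} {x y : LinkedWallVertex n sub}
    (hx : IsThirdNeighbor v x) (hy : IsThirdNeighbor v y) : x = y := by
  obtain ⟨a, rfl, ha⟩ := hx
  obtain ⟨b, rfl, hb⟩ := hy
  have h1 : a.row ≤ n := a.2.2.1
  have h2 : b.row ≤ n := b.2.2.1
  rw [Nat.even_iff] at hn
  have : a = b := by
    apply Subtype.ext
    simp only [WallVertex.Above, WallVertex.GreyPair, Nat.odd_iff] at ha hb
    apply Prod.ext
    · change a.col = b.col
      omega
    · change a.row = b.row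
      omega
  rw [this]

theorem neighbor_cases {grey : Prop} {v : WallVertex n} {x : LinkedWallVertex n sub}
    (hadj : (linkedWall n sub grey).Adj (wall v) x) :
    IsLeftNeighbor v x ∨ IsRightNeighbor v x ∨ IsThirdNeighbor v x := by
  rcases hadj.2 with h | h
  · cases h with
    | horizontal _ v' h => exact Or.inr (Or.inl (Or.inl ⟨v', rfl, h⟩))
    | vertical _ v' h => exact Or.inr (Or.inr ⟨v', rfl, Or.inl h⟩)
    | greyEdge _ v' _ h => exact Or.inr (Or.inr ⟨v', rfl, by tauto⟩)
    | rightLink _ h hs => exact Or.inr (Or.inl (Or.inr (Or.inl ⟨h, hs, rfl⟩)))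
    | rightLinkInner _ h hs => exact Or.inr (Or.inl (Or.inr (Or.inr ⟨h, _, hs, rfl⟩)))
  · cases h with
    | horizontal v' _ h => exact Or.inl (Or.inl ⟨v', rfl, h⟩)
    | vertical v' _ h => exact Or.inr (Or.inr ⟨v', rfl, by tauto⟩)
    | greyEdge v' _ _ h => exact Or.inr (Or.inr ⟨v', rfl, by tauto⟩)
    | leftLink _ h hs => exact Or.inl (Or.inr (Or.inl ⟨h, hs, rfl⟩))
    | leftLinkInner _ h hs => exact Or.inl (Or.inr (Or.inr ⟨h, _, hs, rfl⟩))

theorem mem_linkedWallA {x : LinkedWallVertex n sub} :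
    x ∈ linkedWallA n sub ↔ x = left ∨ x = right := Iff.rfl

theorem wall_notMem_linkedWallA (v : WallVertex n) : wall v ∉ linkedWallA n sub := by
  simp [mem_linkedWallA]

/-- The two vertices are the ends of a grey edge. -/
def IsGrey (x y : LinkedWallVertex n sub) : Prop :=
  ∃ v v' : WallVertex n, v.GreyPair v' ∧ s(x, y) = s(wall v, wall v')

/-- Translates walks into grid walks. For a neighbour in `A` only the column matters, since
`A`-vertices have no meaningful row. -/
theorem pos_of_adj {grey : Prop} {x y : LinkedWallVertex n sub}
    (hadj : (linkedWall n sub grey).Adj x y) (hx : x ∉ linkedWallA n sub) :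
    (y ∈ linkedWallA n sub ∧ x.pos.1 = y.pos.1) ∨
      (y ∉ linkedWallA n sub ∧ (x.pos = y.pos ∨ GridAdj x.pos y.pos ∨ IsGrey x y)) := by
  simp only [mem_linkedWallA] at *
  rcases hadj.2 with h | h
  · cases h with
    | horizontal v v' h =>
      simp only [WallVertex.LeftOf, WallVertex.row, WallVertex.col] at h
      simp only [pos, GridAdj]; simp; omega
    | vertical v v' h =>
      simp only [WallVertex.Above, WallVertex.row, WallVertex.col] at h
      simp only [pos, GridAdj]; simp; omega
    | greyEdge v v' hg h => exact Or.inr ⟨by simp, Or.inr (Or.inr ⟨v, v', h, rfl⟩)⟩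
    | leftLink => simp at hx
    | leftLinkOuter => simp at hx
    | leftLinkInner => simp [pos]
    | rightLink v h => exact Or.inl ⟨by simp, h⟩
    | rightLinkInner => simp [pos]
    | rightLinkOuter v h => exact Or.inl ⟨by simp, h⟩
  · cases h with
    | horizontal v v' h =>
      simp only [WallVertex.LeftOf, WallVertex.row, WallVertex.col] at h
      simp only [pos, GridAdj]; simp; omega
    | vertical v v' h =>
      simp only [WallVertex.Above, WallVertex.row, WallVertex.col] at h
      simp only [pos, GridAdj]; simp; omega
    | greyEdge v v' hg h => exact Or.inr ⟨by simp, Or.inr (Or.inr ⟨v, v', h, Sym2.eq_swap⟩)⟩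
    | leftLink v h => exact Or.inl ⟨by simp, h⟩
    | leftLinkOuter v h => exact Or.inl ⟨by simp, h⟩
    | leftLinkInner => simp [pos]
    | rightLink => simp at hx
    | rightLinkInner => simp [pos]
    | rightLinkOuter => simp at hx

end LinkedWallVertex

/-! ## Two `A`-paths that meet the top row -/

open LinkedWallVertex

section Crossing

variable {n : ℕ} {sub : WallVertex n → Prop} {grey : Prop}

/-- The grid points covered by a walk when each grey edge is replaced by the two edges of the top
row below it. -/
def gridTrace {s t : LinkedWallVertex n sub} (p : (linkedWall n sub grey).Walk s t) :
    Set (ℕ × ℕ) :=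
  {z | (∃ v, wall v ∈ p.support ∧ z = v.1) ∨
    ∃ v v' : WallVertex n, v.GreyPair v' ∧ s(wall v, wall v') ∈ p.edges ∧ z = (v.col + 1, n)}

theorem gridTrace_mono {s t s' t' : LinkedWallVertex n sub} {p : (linkedWall n sub grey).Walk s t}
    {q : (linkedWall n sub grey).Walk s' t'} (h1 : p.support ⊆ q.support)
    (h2 : p.edges ⊆ q.edges) : gridTrace p ⊆ gridTrace q := by
  rintro z (⟨v, hv, rfl⟩ | ⟨v, v', h, he, rfl⟩)
  · exact Or.inl ⟨v, h1 hv, rfl⟩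
  · exact Or.inr ⟨v, v', h, h2 he, rfl⟩

theorem gridTrace_bounds {s t : LinkedWallVertex n sub} {p : (linkedWall n sub grey).Walk s t}
    {z : ℕ × ℕ} (hz : z ∈ gridTrace p) : z.1 ≤ 2 * n + 1 ∧ z.2 ≤ n := by
  rcases hz with ⟨v, -, rfl⟩ | ⟨v, v', ⟨h1, h2, h3, h4⟩, -, rfl⟩
  · exact ⟨v.2.1, v.2.2.1⟩
  · have : v'.col ≤ 2 * n + 1 := v'.2.1
    exact ⟨by simp only; omega, le_rfl⟩

/-- A walk that enters `A` only at its end leads, within its trace, to the corresponding side. -/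
theorem exists_reflTransGen_side {S : Set (ℕ × ℕ)} {x e : LinkedWallVertex n sub}
    (p : (linkedWall n sub grey).Walk x e) (hpS : gridTrace p ⊆ S) (hx : x ∉ linkedWallA n sub)
    (he : e ∈ linkedWallA n sub) (hA : ∀ v ∈ p.support, v ∈ linkedWallA n sub → v = e)
    (hxS : x.pos ∈ S) :
    ∃ z ∈ S, z.1 = e.pos.1 ∧ Relation.ReflTransGen (GridStep S) x.pos z := by
  induction p with
  | nil => exact absurd he hx
  | @cons x y e h q ih =>
    rcases pos_of_adj h hx with ⟨hy, hxy⟩ | ⟨hy, hxy⟩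
    · obtain rfl : y = e := hA y (by simp) hy
      exact ⟨x.pos, hxS, hxy, .refl⟩
    have hq : gridTrace q ⊆ S :=
      (gridTrace_mono (by simp) (by simp)).trans hpS
    have step : y.pos ∈ S ∧ Relation.ReflTransGen (GridStep S) x.pos y.pos := by
      rcases hxy with hxy | hxy | ⟨v, v', hg, hxy⟩
      · rw [← hxy]; exact ⟨hxS, .refl⟩
      · have hyS : y.pos ∈ S := by
          cases y with
          | left => exact absurd (Or.inl rfl) hy
          | right => exact absurd (Or.inr rfl) hy
          | wall v => exact hpS (Or.inl ⟨v, by simp, rfl⟩)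
          -- A subdividing vertex is not recorded in the trace, but it has the position of its only
          -- neighbour outside `A`, which is `x`.
          | mid v hv hs =>
            have : x.pos = v.1 := by
              rcases h.2 with h | h
              · cases h with
                | leftLinkOuter => exact absurd (Or.inl rfl) hx
                | rightLinkInner => rfl
              · cases h with
                | leftLinkInner => rfl
                | rightLinkOuter => exact absurd (Or.inr rfl) hx
            change v.1 ∈ S
            rwa [← this]
        exact ⟨hyS, .single ⟨hxy, hxS, hyS⟩⟩
      -- A grey edge becomes two grid steps through the top point between its ends.
      · have hm : (v.col + 1, n) ∈ S := hpS (Or.inr ⟨v, v', hg, by simp [hxy], rfl⟩)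
        have hmem : ∀ u : WallVertex n, wall u = x ∨ wall u = y → u.1 ∈ S := by
          rintro u (rfl | rfl)
          · exact hxS
          · exact hpS (Or.inl ⟨u, by simp, rfl⟩)
        obtain ⟨g1, g2, g3, g4⟩ := hg
        simp only [WallVertex.row, WallVertex.col] at g1 g2 g3 g4 hm
        rcases Sym2.eq_iff.1 hxy with ⟨rfl, rfl⟩ | ⟨rfl, rfl⟩
        · have hyS := hmem v' (Or.inr rfl)
          refine ⟨hyS, .head (b := (v.1.1 + 1, n)) ⟨?_, hxS, hm⟩ (.single ⟨?_, hm, hyS⟩)⟩ <;>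
          simp only [pos, GridAdj, true_or, and_true] <;> omega
        · have hyS := hmem v (Or.inr rfl)
          refine ⟨hyS, .head (b := (v.1.1 + 1, n)) ⟨?_, hxS, hm⟩ (.single ⟨?_, hm, hyS⟩)⟩ <;>
          simp only [pos, GridAdj, or_true, and_true] <;> omega
    obtain ⟨z, hz, hze, hyz⟩ := ih hq hy he
      (fun v hv => hA v (by simp [hv])) step.1
    exact ⟨z, hz, hze, step.2.trans hyz⟩

/-- Edge-disjoint `A`-paths do not share a wall vertex. -/
theorem not_mem_support_of_edges_disjoint (hn : Even n) {s t s' t' : LinkedWallVertex n sub}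
    {p : (linkedWall n sub grey).Walk s t} {q : (linkedWall n sub grey).Walk s' t'}
    (hp : IsAPath (linkedWallA n sub) p) (hq : IsAPath (linkedWallA n sub) q)
    (hpq : List.Disjoint p.edges q.edges) {v : WallVertex n} (hvp : wall v ∈ p.support)
    (hvq : wall v ∈ q.support) : False := by
  have hA : ∀ y ∈ linkedWallA n sub, wall v ≠ y := by
    rintro y hy rfl; exact wall_notMem_linkedWallA v hy
  obtain ⟨x, y, hxy, hx, hy⟩ :=
    hp.1.exists_two_edges hvp (hA _ hp.2.2.1) (hA _ hp.2.2.2.1)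
  obtain ⟨x', y', hxy', hx', hy'⟩ :=
    hq.1.exists_two_edges hvq (hA _ hq.2.2.1) (hA _ hq.2.2.2.1)
  have h1 : x ≠ x' := by rintro rfl; exact hpq hx hx'
  have h2 : x ≠ y' := by rintro rfl; exact hpq hx hy'
  have h3 : y ≠ x' := by rintro rfl; exact hpq hy hx'
  have h4 : y ≠ y' := by rintro rfl; exact hpq hy hy'
  have uL := fun {x y : LinkedWallVertex n sub} => IsLeftNeighbor.unique (v := v) (x := x) (y := y)
  have uR := fun {x y : LinkedWallVertex n sub} => IsRightNeighbor.unique (v := v) (x := x) (y := y)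
  have uT := fun {x y : LinkedWallVertex n sub} =>
    IsThirdNeighbor.unique hn (v := v) (x := x) (y := y)
  -- The four distinct neighbours fall into three kinds with at most one neighbour each.
  rcases neighbor_cases (p.adj_of_mem_edges hx) with a | a | a <;>
  rcases neighbor_cases (p.adj_of_mem_edges hy) with b | b | b <;>
  rcases neighbor_cases (q.adj_of_mem_edges hx') with c | c | c <;>
  first
  | exact hxy (uL a b) | exact hxy (uR a b) | exact hxy (uT a b)
  | exact h1 (uL a c) | exact h1 (uR a c) | exact h1 (uT a c)
  | exact h3 (uL b c) | exact h3 (uR b c) | exact h3 (uT b c)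
  | rcases neighbor_cases (q.adj_of_mem_edges hy') with d | d | d <;>
    first
    | exact hxy' (uL c d) | exact hxy' (uR c d) | exact hxy' (uT c d)
    | exact h2 (uL a d) | exact h2 (uR a d) | exact h2 (uT a d)
    | exact h4 (uL b d) | exact h4 (uR b d) | exact h4 (uT b d)

/-- An `A`-path that contains a grey edge is vertex-disjoint from the top vertex below this edge
for every `A`-path that is edge-disjoint from it. -/
theorem not_mem_support_of_grey (hn : Even n) {s t s' t' : LinkedWallVertex n sub}
    {p : (linkedWall n sub grey).Walk s t} {q : (linkedWall n sub grey).Walk s' t'}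
    (hp : IsAPath (linkedWallA n sub) p) (hq : IsAPath (linkedWallA n sub) q)
    (hpq : List.Disjoint p.edges q.edges) {v v' w : WallVertex n} (hg : v.GreyPair v')
    (he : s(wall v, wall v') ∈ p.edges) (hw : w.1 = (v.col + 1, n))
    (hwq : wall w ∈ q.support) : False := by
  have hA : ∀ y ∈ linkedWallA n sub, wall w ≠ y := by
    rintro y hy rfl; exact wall_notMem_linkedWallA w hy
  obtain ⟨x, y, hxy, hx, hy⟩ :=
    hq.1.exists_two_edges hwq (hA _ hq.2.2.1) (hA _ hq.2.2.2.1)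
  have hvq : wall v ∉ q.support := fun h =>
    not_mem_support_of_edges_disjoint hn hp hq hpq (p.fst_mem_support_of_mem_edges he) h
  have hvq' : wall v' ∉ q.support := fun h =>
    not_mem_support_of_edges_disjoint hn hp hq hpq (p.snd_mem_support_of_mem_edges he) h
  obtain ⟨g1, g2, g3, g4⟩ := hg
  have hwc : w.col = v.col + 1 := congrArg Prod.fst hw
  have hwr : w.row = n := congrArg Prod.snd hw
  -- The horizontal neighbours of `w` are the ends of the grey edge and lie on `p`, so only one edge
  -- at `w` remains for `q`, which needs two.
  have third : ∀ z, s(wall w, z) ∈ q.edges → IsThirdNeighbor w z := by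
    intro z hz
    have hzq := q.snd_mem_support_of_mem_edges hz
    rcases neighbor_cases (q.adj_of_mem_edges hz) with h | h | h
    · obtain rfl : z = wall v := h.unique (Or.inl ⟨v, rfl, by omega, hwc.symm⟩)
      exact absurd hzq hvq
    · obtain rfl : z = wall v' := h.unique (Or.inl ⟨v', rfl, by omega, by omega⟩)
      exact absurd hzq hvq'
    · exact h
  exact hxy ((third x hx).unique hn (third y hy))

theorem gridTrace_disjoint (hn : Even n) {s t s' t' : LinkedWallVertex n sub}
    {p : (linkedWall n sub grey).Walk s t} {q : (linkedWall n sub grey).Walk s' t'}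
    (hp : IsAPath (linkedWallA n sub) p) (hq : IsAPath (linkedWallA n sub) q)
    (hpq : List.Disjoint p.edges q.edges) : Disjoint (gridTrace p) (gridTrace q) := by
  rw [Set.disjoint_left]
  rintro z (⟨v, hv, rfl⟩ | ⟨v, v', hg, he, rfl⟩) (⟨w, hw, hz⟩ | ⟨w, w', hg', he', hz⟩)
  · obtain rfl : v = w := Subtype.ext hz
    exact not_mem_support_of_edges_disjoint hn hp hq hpq hv hw
  · exact not_mem_support_of_grey hn hq hp hpq.symm hg' he' hz hv
  · exact not_mem_support_of_grey hn hp hq hpq hg he hz.symm hw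
  · obtain rfl : v = w := by
      apply Subtype.ext
      apply Prod.ext
      · have := congrArg Prod.fst hz
        change v.col + 1 = w.col + 1 at this
        change v.col = w.col
        omega
      · exact hg.1.trans hg'.1.symm
    exact not_mem_support_of_edges_disjoint hn hp hq hpq (p.fst_mem_support_of_mem_edges he)
      (q.fst_mem_support_of_mem_edges he')

/-- The wall vertices of an `A`-path are connected to both sides within its trace. -/
theorem IsAPath.exists_sides {s t : LinkedWallVertex n sub}
    {p : (linkedWall n sub grey).Walk s t} (hp : IsAPath (linkedWallA n sub) p)
    {v : WallVertex n} (hv : wall v ∈ p.support) :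
    (∃ z ∈ gridTrace p, z.1 = 0 ∧ Relation.ReflTransGen (GridStep (gridTrace p)) v.1 z) ∧
    ∃ z ∈ gridTrace p, z.1 = 2 * n + 1 ∧
      Relation.ReflTransGen (GridStep (gridTrace p)) v.1 z := by
  classical
  obtain ⟨hpath, hst, hs, ht, hA⟩ := hp
  have hvA := wall_notMem_linkedWallA (sub := sub) v
  have hvS : (wall v : LinkedWallVertex n sub).pos ∈ gridTrace p := Or.inl ⟨v, hv, rfl⟩
  -- Stated for a general path so that it serves `p` and its reverse; going back from `v` to the
  -- start, the path meets `A` only there.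
  have to_end : ∀ {s t : LinkedWallVertex n sub} (q : (linkedWall n sub grey).Walk s t),
      q.IsPath → s ∈ linkedWallA n sub → (∀ x ∈ q.support, x ∈ linkedWallA n sub → x = s ∨ x = t) →
      gridTrace q ⊆ gridTrace p → wall v ∈ q.support → t ∈ linkedWallA n sub →
      ∃ z ∈ gridTrace p, z.1 = s.pos.1 ∧
        Relation.ReflTransGen (GridStep (gridTrace p)) v.1 z := by
    intro s t q hq hs hqA hqp hvq ht
    refine exists_reflTransGen_side (q.takeUntil _ hvq).reverse ?_ hvA hs ?_ hvS
    · refine (gridTrace_mono ?_ ?_).trans hqp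
      · simpa using q.support_takeUntil_subset_support hvq
      · simpa using q.edges_takeUntil_subset_edges hvq
    · intro x hx hxA
      rw [SimpleGraph.Walk.support_reverse, List.mem_reverse] at hx
      refine (hqA x (q.support_takeUntil_subset_support hvq hx) hxA).resolve_right ?_
      rintro rfl
      refine SimpleGraph.Walk.endpoint_notMem_support_takeUntil hq hvq ?_ hx
      rintro rfl
      exact hvA ht
  have h1 := to_end p hpath hs hA subset_rfl hv ht
  have h2 := to_end p.reverse hpath.reverse ht
    (fun x hx hxA => (hA x (by simpa using hx) hxA).symm)
    (gridTrace_mono (by simp) (by simp)) (by simpa using hv) hs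
  rcases hs with rfl | rfl <;> rcases ht with rfl | rfl
  · exact absurd rfl hst
  · exact ⟨h1, h2⟩
  · exact ⟨h2, h1⟩
  · exact absurd rfl hst

/-- Two `A`-paths that meet the top row of the wall share an edge. -/
theorem not_edges_disjoint_of_top (hn : Even n) {s t s' t' : LinkedWallVertex n sub}
    {p : (linkedWall n sub grey).Walk s t} {q : (linkedWall n sub grey).Walk s' t'}
    (hp : IsAPath (linkedWallA n sub) p) (hq : IsAPath (linkedWallA n sub) q)
    (hpt : ∃ v : WallVertex n, v.OnTop ∧ wall v ∈ p.support)
    (hqt : ∃ v : WallVertex n, v.OnTop ∧ wall v ∈ q.support) :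
    ¬ List.Disjoint p.edges q.edges := by
  intro hpq
  obtain ⟨v, hv, hvp⟩ := hpt
  obtain ⟨w, hw, hwq⟩ := hqt
  wlog hvw : v.col ≤ w.col generalizing s t s' t' p q v w
  · exact this hq hp hpq.symm w hw hwq v hv hvp (le_of_not_ge hvw)
  -- Now `q` joins the left side to the top at `w`, while `p` joins `v`, which is not to the right
  -- of `w`, to the right side.
  obtain ⟨-, z, hz, hz0, hvz⟩ := hp.exists_sides hvp
  obtain ⟨⟨z', hz', hz0', hwz'⟩, -⟩ := hq.exists_sides hwq
  exact grid_crossing (gridTrace_disjoint hn hq hp hpq.symm)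
    (fun _ => gridTrace_bounds) (fun _ => gridTrace_bounds) hz0' hw hv hz0 hvw hz'
    (Or.inl ⟨w, hwq, rfl⟩) (Or.inl ⟨v, hvp, rfl⟩) (GridStep.reflTransGen_symm hwz') hvz

theorem not_hasEdgeDisjoint_two (hn : Even n)
    {T : ∀ ⦃s t : LinkedWallVertex n sub⦄, (linkedWall n sub grey).Walk s t → Prop}
    (hT : ∀ ⦃s t⦄ (p : (linkedWall n sub grey).Walk s t), T p → IsAPath (linkedWallA n sub) p ∧
      ∃ v : WallVertex n, v.OnTop ∧ wall v ∈ p.support) : ¬ HasEdgeDisjoint T 2 := by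
  rintro ⟨s, t, P, hP, hd⟩
  exact not_edges_disjoint_of_top hn (hT _ (hP 0)).1 (hT _ (hP 1)).1 (hT _ (hP 0)).2
    (hT _ (hP 1)).2 (hd 0 1 (by decide))

end Crossing

/-! ## Paths through prescribed regions -/

/-- The vertices `x` and `y` of the region `R` are joined by an edge outside `Z`. -/
def AvoidStep {V : Type u} (G : SimpleGraph V) (Z : Finset (Sym2 V)) (R : Set V) (x y : V) : Prop :=
  G.Adj x y ∧ s(x, y) ∉ Z ∧ x ∈ R ∧ y ∈ R

theorem AvoidStep.symm {V : Type u} {G : SimpleGraph V} {Z : Finset (Sym2 V)} {R : Set V} {x y : V}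
    (h : AvoidStep G Z R x y) : AvoidStep G Z R y x :=
  ⟨h.1.symm, by rw [Sym2.eq_swap]; exact h.2.1, h.2.2.2, h.2.2.1⟩

theorem AvoidStep.reflTransGen_symm {V : Type u} {G : SimpleGraph V} {Z : Finset (Sym2 V)}
    {R : Set V} {x y : V} (h : Relation.ReflTransGen (AvoidStep G Z R) x y) :
    Relation.ReflTransGen (AvoidStep G Z R) y x := by
  have : Std.Symm (AvoidStep G Z R) := ⟨fun _ _ h => h.symm⟩
  exact symm_of (Relation.ReflTransGen (AvoidStep G Z R)) h

theorem exists_isPath_of_avoidStep {V : Type u} {G : SimpleGraph V} {Z : Finset (Sym2 V)}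
    {R : Set V} {x y : V} (hx : x ∈ R) (h : Relation.ReflTransGen (AvoidStep G Z R) x y) :
    ∃ p : G.Walk x y, p.IsPath ∧ (∀ v ∈ p.support, v ∈ R) ∧ ∀ e ∈ p.edges, e ∉ Z := by
  classical
  have : ∃ p : G.Walk x y, (∀ v ∈ p.support, v ∈ R) ∧ ∀ e ∈ p.edges, e ∉ Z := by
    induction h with
    | refl => exact ⟨.nil, by simpa using hx, by simp⟩
    | tail _ hbc ih =>
      obtain ⟨p, hp, hpZ⟩ := ih
      refine ⟨p.concat hbc.1, ?_, ?_⟩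
      · intro v hv
        rw [SimpleGraph.Walk.support_concat, List.mem_append, List.mem_singleton] at hv
        rcases hv with hv | rfl
        exacts [hp v hv, hbc.2.2.2]
      · intro e he
        rw [SimpleGraph.Walk.edges_concat, List.concat_eq_append, List.mem_append,
          List.mem_singleton] at he
        rcases he with he | rfl
        exacts [hpZ e he, hbc.2.1]
  obtain ⟨p, hp, hpZ⟩ := this
  exact ⟨p.bypass, p.bypass_isPath, fun v hv => hp v (p.support_bypass_subset_support hv),
    fun e he => hpZ e (p.edges_bypass_subset_edges he)⟩

theorem linkedWall_adj_of_arc {n : ℕ} {sub : WallVertex n → Prop} {grey : Prop}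
    {x y : LinkedWallVertex n sub} (h : LinkedWallArc n sub grey x y) :
    (linkedWall n sub grey).Adj x y :=
  ⟨by rintro rfl; exact h.asymm h, Or.inl h⟩

/-! ## Rows and blocks of the linked wall -/


section Avoiding

variable {n : ℕ} {sub : WallVertex n → Prop} {grey : Prop}

theorem WallVertex.exists_of_row_pos (hn : Even n) {x y : ℕ} (hx : x ≤ 2 * n + 1) (hy : y ≤ n)
    (hy0 : 0 < y) (hxy : x ≤ 2 * n ∨ y < n) : ∃ v : WallVertex n, v.col = x ∧ v.row = y := by
  refine ⟨⟨(x, y), hx, hy, ?_, ?_⟩, rfl, rfl⟩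
  · simp; omega
  · rw [if_pos hn]; simp; omega

/-- Row `j` of the wall together with its links. -/
def rowSet (n : ℕ) (sub : WallVertex n → Prop) (j : ℕ) : Set (LinkedWallVertex n sub) :=
  {x | x = left ∨ x = right ∨ (∃ v, v.row = j ∧ x = wall v) ∨
    ∃ v h hs, v.row = j ∧ x = mid v h hs}

/-- The columns `4i, …, 4i + 3` of the wall. -/
def blockSet (n : ℕ) (sub : WallVertex n → Prop) (i : ℕ) : Set (LinkedWallVertex n sub) :=
  {x | ∃ v : WallVertex n, v.col / 4 = i ∧ x = wall v}

/-- A set that contains an edge inside each of the sets `D 0, …, D (r - 1)`, no two of which have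
an edge in common, has at least `r` elements. -/
theorem le_card_of_inter_edgeFree {V : Type u} {G : SimpleGraph V} {Z : Finset (Sym2 V)} {r : ℕ}
    (D : ℕ → Set V) (hD : ∀ i i' x y, x ∈ D i → y ∈ D i → x ∈ D i' → y ∈ D i' → G.Adj x y → i = i')
    (h : ∀ i < r, ∃ x y, x ∈ D i ∧ y ∈ D i ∧ G.Adj x y ∧ s(x, y) ∈ Z) : r ≤ Z.card := by
  have h' : ∀ i : Fin r, ∃ x y, x ∈ D i ∧ y ∈ D i ∧ G.Adj x y ∧ s(x, y) ∈ Z := fun i => h i i.2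
  choose x y hx hy hadj hZ using h'
  have := Finset.card_le_card_of_injOn (s := Finset.univ) (t := Z) (fun i => s(x i, y i))
    (fun i _ => hZ i) ?_
  · simpa using this
  · intro i _ i' _ he
    apply Fin.ext
    rcases Sym2.eq_iff.1 he with ⟨h1, h2⟩ | ⟨h1, h2⟩
    · exact hD i i' _ _ (hx i) (hy i) (h1 ▸ hx i') (h2 ▸ hy i') (hadj i)
    · exact hD i i' _ _ (hx i) (hy i) (h1 ▸ hy i') (h2 ▸ hx i') (hadj i)

/-- The set `Z` contains no edge inside `D`. -/
def EdgeFree {V : Type u} (G : SimpleGraph V) (Z : Finset (Sym2 V)) (D : Set V) : Prop :=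
  ∀ x y, x ∈ D → y ∈ D → G.Adj x y → s(x, y) ∉ Z

/-- Different rows share only the two `A`-vertices, which are not adjacent. Odd rows are used
because there the vertical edges at even columns go up, as the zigzag of `reflTransGen_column`
requires. -/
theorem exists_edgeFree_row {r : ℕ} {Z : Finset (Sym2 (LinkedWallVertex n sub))} (hZ : Z.card < r) :
    ∃ m < r, EdgeFree (linkedWall n sub grey) Z (rowSet n sub (2 * m + 1)) := by
  by_contra! hcon
  refine hZ.not_ge (le_card_of_inter_edgeFree (G := linkedWall n sub grey)
    (fun m => rowSet n sub (2 * m + 1)) ?_ ?_)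
  · have key : ∀ i i' (x : LinkedWallVertex n sub), x ∈ rowSet n sub (2 * i + 1) →
        x ∈ rowSet n sub (2 * i' + 1) → x = left ∨ x = right ∨ i = i' := by
      rintro i i' x (rfl | rfl | ⟨v, hv, rfl⟩ | ⟨v, h, hs, hv, rfl⟩) hx
      · exact Or.inl rfl
      · exact Or.inr (Or.inl rfl)
      · rcases hx with hx | hx | ⟨w, hw, hx⟩ | ⟨w, h, hs, hw, hx⟩ <;> cases hx
        omega
      · rcases hx with hx | hx | ⟨w, hw, hx⟩ | ⟨w, h, hs, hw, hx⟩ <;> cases hx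
        omega
    intro i i' x y hx hy hx' hy' hadj
    have hA : ∀ a b : LinkedWallVertex n sub, (a = left ∨ a = right) → (b = left ∨ b = right) →
        ¬ LinkedWallArc n sub grey a b := by
      rintro _ _ (rfl | rfl) (rfl | rfl) h <;> cases h
    rcases key i i' x hx hx' with h1 | h1 | h1 <;> rcases key i i' y hy hy' with h2 | h2 | h2 <;>
    first
    | exact h1
    | exact h2
    | exact (hadj.2.elim (hA x y (by tauto) (by tauto)) (hA y x (by tauto) (by tauto))).elim
  · intro m hm
    have := hcon m hm
    unfold EdgeFree at this
    push Not at this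
    exact this

theorem exists_edgeFree_block {r : ℕ} {Z : Finset (Sym2 (LinkedWallVertex n sub))}
    (hZ : Z.card < r) : ∃ i < r, EdgeFree (linkedWall n sub grey) Z (blockSet n sub i) := by
  by_contra! hcon
  refine hZ.not_ge (le_card_of_inter_edgeFree (G := linkedWall n sub grey) (blockSet n sub) ?_ ?_)
  · rintro i i' x y ⟨v, hv, rfl⟩ - ⟨v', hv', h⟩ - -
    cases h
    omega
  · intro m hm
    have := hcon m hm
    unfold EdgeFree at this
    push Not at this
    exact this

variable {Z : Finset (Sym2 (LinkedWallVertex n sub))} {R : Set (LinkedWallVertex n sub)} {i j : ℕ}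

theorem reflTransGen_row (hn : Even n) (hj0 : 0 < j) (hjn : j < n)
    (hrow : EdgeFree (linkedWall n sub grey) Z (rowSet n sub j)) {v w : WallVertex n}
    (hv : v.row = j) (hw : w.row = j) (hvw : v.col ≤ w.col)
    (hR : ∀ u : WallVertex n, u.row = j → v.col ≤ u.col → u.col ≤ w.col → wall u ∈ R) :
    Relation.ReflTransGen (AvoidStep (linkedWall n sub grey) Z R) (wall v) (wall w) := by
  obtain ⟨k, hk⟩ := Nat.exists_eq_add_of_le hvw
  clear hvw
  induction k generalizing w with
  | zero => rw [WallVertex.ext (v := v) (w := w) (by omega) (by omega)]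
  | succ k ih =>
    have hw1 : w.col ≤ 2 * n + 1 := w.2.1
    obtain ⟨u, hu, hu'⟩ := WallVertex.exists_of_row_pos hn (x := v.col + k) (y := j)
      (by omega) hjn.le hj0 (Or.inr hjn)
    refine (ih hu' (fun x h1 h2 h3 => hR x h1 h2 (by omega)) hu).tail ?_
    have hadj : (linkedWall n sub grey).Adj (wall u) (wall w) :=
      linkedWall_adj_of_arc (.horizontal u w ⟨by omega, by omega⟩)
    exact ⟨hadj, hrow _ _ (Or.inr (Or.inr (Or.inl ⟨u, hu', rfl⟩)))
      (Or.inr (Or.inr (Or.inl ⟨w, hw, rfl⟩))) hadj, hR u hu' (by omega) (by omega),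
      hR w hw (by omega) le_rfl⟩

/-- The zigzag from row `j` to the top within the columns `c` and `c + 1`. -/
theorem reflTransGen_column (hn : Even n) (hj : Odd j)
    (hblock : EdgeFree (linkedWall n sub grey) Z (blockSet n sub i)) {c : ℕ} (hc : Even c)
    (hci : c / 4 = i) {v w : WallVertex n} (hv : v.row = j) (hvc : v.col = c) (hw : w.row = n)
    (hwc : w.col = c)
    (hR : ∀ u : WallVertex n, j ≤ u.row → c ≤ u.col → u.col ≤ c + 1 → wall u ∈ R) :
    Relation.ReflTransGen (AvoidStep (linkedWall n sub grey) Z R) (wall v) (wall w) := by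
  rw [Nat.even_iff] at hn hc
  rw [Nat.odd_iff] at hj
  have hvn : v.row ≤ n := v.2.2.1
  have hc' : c ≤ 2 * n + 1 := hvc ▸ v.2.1
  have mem : ∀ u : WallVertex n, j ≤ u.row → c ≤ u.col → u.col ≤ c + 1 →
      wall u ∈ R ∧ wall u ∈ blockSet n sub i :=
    fun u h1 h2 h3 => ⟨hR u h1 h2 h3, u, by omega, rfl⟩
  have step : ∀ x y : WallVertex n, LinkedWallArc n sub grey (wall x) (wall y) →
      (j ≤ x.row ∧ c ≤ x.col ∧ x.col ≤ c + 1) → (j ≤ y.row ∧ c ≤ y.col ∧ y.col ≤ c + 1) →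
      AvoidStep (linkedWall n sub grey) Z R (wall x) (wall y) := by
    intro x y h hx hy
    have hx' := mem x hx.1 hx.2.1 hx.2.2
    have hy' := mem y hy.1 hy.2.1 hy.2.2
    have hadj := linkedWall_adj_of_arc h
    exact ⟨hadj, hblock _ _ hx'.2 hy'.2 hadj, hx'.1, hy'.1⟩
  -- One round of the zigzag climbs two rows: up in column `c`, right, up in column `c + 1`, left.
  -- It ends in row `n - 1`, which is odd, and one more vertical edge reaches the top.
  have up : ∀ d (u : WallVertex n), u.row = j + 2 * d → u.col = c →
      Relation.ReflTransGen (AvoidStep (linkedWall n sub grey) Z R) (wall v) (wall u) := by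
    intro d
    induction d with
    | zero => intro u hu huc; rw [WallVertex.ext (v := v) (w := u) (by omega) (by omega)]
    | succ d ih =>
      intro u hu huc
      have hun : u.row ≤ n := u.2.2.1
      have ne : Even n := Nat.even_iff.2 hn
      obtain ⟨a, ha, ha'⟩ := WallVertex.exists_of_row_pos ne (x := c) (y := j + 2 * d)
        (by omega) (by omega) (by omega) (Or.inl (by omega))
      obtain ⟨b, hb, hb'⟩ := WallVertex.exists_of_row_pos ne (x := c) (y := j + 2 * d + 1)
        (by omega) (by omega) (by omega) (Or.inl (by omega))
      obtain ⟨b₁, hb₁, hb₁'⟩ := WallVertex.exists_of_row_pos ne (x := c + 1) (y := j + 2 * d + 1)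
        (by omega) (by omega) (by omega) (Or.inr (by omega))
      obtain ⟨a₁, ha₁, ha₁'⟩ := WallVertex.exists_of_row_pos ne (x := c + 1) (y := j + 2 * d + 2)
        (by omega) (by omega) (by omega) (Or.inr (by omega))
      have s1 := (step b a (.vertical _ _ ⟨by omega, by omega, by rw [Nat.odd_iff]; omega⟩)
        (by omega) (by omega)).symm
      have s2 := step b b₁ (.horizontal _ _ ⟨by omega, by omega⟩) (by omega) (by omega)
      have s3 := (step a₁ b₁ (.vertical _ _ ⟨by omega, by omega, by rw [Nat.odd_iff]; omega⟩)
        (by omega) (by omega)).symm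
      have s4 := (step u a₁ (.horizontal _ _ ⟨by omega, by omega⟩) (by omega) (by omega)).symm
      exact ((((ih a ha' ha).tail s1).tail s2).tail s3).tail s4
  obtain ⟨u, hu, hu'⟩ := WallVertex.exists_of_row_pos (Nat.even_iff.2 hn) (x := c) (y := n - 1)
    (by omega) (by omega) (by omega) (Or.inl (by omega))
  refine (up ((n - 1 - j) / 2) u (by omega) hu).tail ?_
  exact (step w u (.vertical _ _ ⟨by omega, by omega, by rw [Nat.odd_iff]; omega⟩)
    (by omega) (by omega)).symm

/-- The part of row `j` to the left of block `i` together with the left half of this block. -/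
def leftRegion (n : ℕ) (sub : WallVertex n → Prop) (i j : ℕ) : Set (LinkedWallVertex n sub) :=
  {x | x = left ∨ (∃ v : WallVertex n, x = wall v ∧ ((v.row = j ∧ v.col ≤ 4 * i) ∨
    (j ≤ v.row ∧ 4 * i ≤ v.col ∧ v.col ≤ 4 * i + 1))) ∨
    ∃ v h hs, v.OnLeftSide ∧ v.row = j ∧ x = mid v h hs}

/-- The part of row `j` to the right of block `i` together with the right half of this block. -/
def rightRegion (n : ℕ) (sub : WallVertex n → Prop) (i j : ℕ) : Set (LinkedWallVertex n sub) :=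
  {x | x = right ∨ (∃ v : WallVertex n, x = wall v ∧ ((v.row = j ∧ 4 * i + 2 ≤ v.col) ∨
    (j ≤ v.row ∧ 4 * i + 2 ≤ v.col ∧ v.col ≤ 4 * i + 3))) ∨
    ∃ v h hs, v.OnRightSide ∧ v.row = j ∧ x = mid v h hs}

theorem leftRegion_disjoint_rightRegion (x : LinkedWallVertex n sub)
    (hx : x ∈ leftRegion n sub i j) : x ∉ rightRegion n sub i j := by
  rintro (rfl | ⟨v, rfl, hv⟩ | ⟨v, h, hs, hv, -, rfl⟩) <;>
  rcases hx with hx | ⟨w, hx, hw⟩ | ⟨w, h, hs, hw, -, hx⟩ <;> cases hx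
  · omega
  · simp only [WallVertex.OnLeftSide, WallVertex.OnRightSide] at hv hw
    omega

/-- As row `j` is not the top row, the region meets the top row in at most two consecutive columns,
whereas a grey edge spans three. -/
theorem not_isGrey_of_mem_leftRegion (hj : j < n) {x y : LinkedWallVertex n sub}
    (hx : x ∈ leftRegion n sub i j) (hy : y ∈ leftRegion n sub i j) : ¬ IsGrey x y := by
  rintro ⟨v, v', ⟨h1, h2, h3, h4⟩, he⟩
  have key : ∀ w : WallVertex n, wall w ∈ leftRegion n sub i j → w.row = n →
      4 * i ≤ w.col ∧ w.col ≤ 4 * i + 1 := by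
    rintro w (h | ⟨v, h, hv⟩ | ⟨v, h, hs, hv, -, h⟩) hw <;> cases h
    omega
  rcases Sym2.eq_iff.1 he with ⟨rfl, rfl⟩ | ⟨rfl, rfl⟩
  · have := key _ hx h1; have := key _ hy h2; omega
  · have := key _ hx h2; have := key _ hy h1; omega

theorem not_isGrey_of_mem_rightRegion (hj : j < n) {x y : LinkedWallVertex n sub}
    (hx : x ∈ rightRegion n sub i j) (hy : y ∈ rightRegion n sub i j) : ¬ IsGrey x y := by
  rintro ⟨v, v', ⟨h1, h2, h3, h4⟩, he⟩
  have key : ∀ w : WallVertex n, wall w ∈ rightRegion n sub i j → w.row = n →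
      4 * i + 2 ≤ w.col ∧ w.col ≤ 4 * i + 3 := by
    rintro w (h | ⟨v, h, hv⟩ | ⟨v, h, hs, hv, -, h⟩) hw <;> cases h
    omega
  rcases Sym2.eq_iff.1 he with ⟨rfl, rfl⟩ | ⟨rfl, rfl⟩
  · have := key _ hx h1; have := key _ hy h2; omega
  · have := key _ hx h2; have := key _ hy h1; omega

theorem reflTransGen_leftRegion (hn : Even n) (hj : Odd j) (hjn : j < n) (hi : 4 * i + 3 ≤ 2 * n)
    (hrow : EdgeFree (linkedWall n sub grey) Z (rowSet n sub j))
    (hblock : EdgeFree (linkedWall n sub grey) Z (blockSet n sub i)) {w : WallVertex n}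
    (hw : w.row = n) (hwc : w.col = 4 * i + 1) :
    Relation.ReflTransGen (AvoidStep (linkedWall n sub grey) Z (leftRegion n sub i j)) left
      (wall w) := by
  have hj0 := hj.pos
  obtain ⟨a, ha, ha'⟩ := WallVertex.exists_of_row_pos hn (x := 0) (y := j)
    (by omega) (by omega) hj0 (Or.inl (by omega))
  obtain ⟨b, hb, hb'⟩ := WallVertex.exists_of_row_pos hn (x := 4 * i) (y := j)
    (by omega) (by omega) hj0 (Or.inl (by omega))
  obtain ⟨c, hc, hc'⟩ := WallVertex.exists_of_row_pos hn (x := 4 * i) (y := n)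
    (by omega) (by omega) (by omega) (Or.inl (by omega))
  have s2 := reflTransGen_row (R := leftRegion n sub i j) hn hj0 hjn hrow ha' hb' (by omega)
    (fun u h1 h2 h3 => Or.inr (Or.inl ⟨u, rfl, by omega⟩))
  have s3 := reflTransGen_column (R := leftRegion n sub i j) hn hj hblock (c := 4 * i)
    (by rw [Nat.even_iff]; omega) (by omega) hb' hb hc' hc
    (fun u h1 h2 h3 => Or.inr (Or.inl ⟨u, rfl, by omega⟩))
  have s4 : AvoidStep (linkedWall n sub grey) Z (leftRegion n sub i j) (wall c) (wall w) := by
    have hadj : (linkedWall n sub grey).Adj (wall c) (wall w) :=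
      linkedWall_adj_of_arc (.horizontal _ _ ⟨by omega, by omega⟩)
    exact ⟨hadj, hblock _ _ ⟨c, by omega, rfl⟩ ⟨w, by omega, rfl⟩ hadj,
      Or.inr (Or.inl ⟨c, rfl, by omega⟩), Or.inr (Or.inl ⟨w, rfl, by omega⟩)⟩
  refine Relation.ReflTransGen.trans ?_ ((s2.trans s3).tail s4)
  have haR : wall a ∈ leftRegion n sub i j := Or.inr (Or.inl ⟨a, rfl, by omega⟩)
  have har : wall a ∈ rowSet n sub j := Or.inr (Or.inr (Or.inl ⟨a, ha', rfl⟩))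
  by_cases hs : sub a
  · have h1 : (linkedWall n sub grey).Adj left (mid a (Or.inl ha) hs) :=
      linkedWall_adj_of_arc (.leftLinkOuter a ha hs)
    have h2 : (linkedWall n sub grey).Adj (mid a (Or.inl ha) hs) (wall a) :=
      linkedWall_adj_of_arc (.leftLinkInner a ha hs)
    have hmR : mid a (Or.inl ha) hs ∈ leftRegion n sub i j :=
      Or.inr (Or.inr ⟨a, _, hs, ha, ha', rfl⟩)
    have hmr : mid a (Or.inl ha) hs ∈ rowSet n sub j :=
      Or.inr (Or.inr (Or.inr ⟨a, _, hs, ha', rfl⟩))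
    exact .head ⟨h1, hrow _ _ (Or.inl rfl) hmr h1, Or.inl rfl, hmR⟩
      (.single ⟨h2, hrow _ _ hmr har h2, hmR, haR⟩)
  · have h1 : (linkedWall n sub grey).Adj left (wall a) :=
      linkedWall_adj_of_arc (.leftLink a ha hs)
    exact .single ⟨h1, hrow _ _ (Or.inl rfl) har h1, Or.inl rfl, haR⟩

theorem reflTransGen_rightRegion (hn : Even n) (hj : Odd j) (hjn : j < n)
    (hi : 4 * i + 3 ≤ 2 * n) (hrow : EdgeFree (linkedWall n sub grey) Z (rowSet n sub j))
    (hblock : EdgeFree (linkedWall n sub grey) Z (blockSet n sub i)) {w : WallVertex n}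
    (hw : w.row = n) (hwc : w.col = 4 * i + 2 ∨ w.col = 4 * i + 3) :
    Relation.ReflTransGen (AvoidStep (linkedWall n sub grey) Z (rightRegion n sub i j)) (wall w)
      right := by
  have hj0 := hj.pos
  obtain ⟨a, ha, ha'⟩ := WallVertex.exists_of_row_pos hn (x := 2 * n + 1) (y := j)
    (by omega) (by omega) hj0 (Or.inr (by omega))
  obtain ⟨b, hb, hb'⟩ := WallVertex.exists_of_row_pos hn (x := 4 * i + 2) (y := j)
    (by omega) (by omega) hj0 (Or.inl (by omega))
  obtain ⟨c, hc, hc'⟩ := WallVertex.exists_of_row_pos hn (x := 4 * i + 2) (y := n)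
    (by omega) (by omega) (by omega) (Or.inl (by omega))
  have s2 := reflTransGen_row (R := rightRegion n sub i j) hn hj0 hjn hrow hb' ha' (by omega)
    (fun u h1 h2 h3 => Or.inr (Or.inl ⟨u, rfl, by omega⟩))
  have s3 := reflTransGen_column (R := rightRegion n sub i j) hn hj hblock (c := 4 * i + 2)
    (by rw [Nat.even_iff]; omega) (by omega) hb' hb hc' hc
    (fun u h1 h2 h3 => Or.inr (Or.inl ⟨u, rfl, by omega⟩))
  have s4 : Relation.ReflTransGen (AvoidStep (linkedWall n sub grey) Z (rightRegion n sub i j))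
      (wall c) (wall w) := by
    rcases hwc with hwc | hwc
    · rw [WallVertex.ext (v := c) (w := w) (by omega) (by omega)]
    have hadj : (linkedWall n sub grey).Adj (wall c) (wall w) :=
      linkedWall_adj_of_arc (.horizontal _ _ ⟨by omega, by omega⟩)
    exact .single ⟨hadj, hblock _ _ ⟨c, by omega, rfl⟩ ⟨w, by omega, rfl⟩ hadj,
      Or.inr (Or.inl ⟨c, rfl, by omega⟩), Or.inr (Or.inl ⟨w, rfl, by omega⟩)⟩
  refine ((AvoidStep.reflTransGen_symm (s3.trans s4)).trans s2).trans ?_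
  have haR : wall a ∈ rightRegion n sub i j := Or.inr (Or.inl ⟨a, rfl, by omega⟩)
  have har : wall a ∈ rowSet n sub j := Or.inr (Or.inr (Or.inl ⟨a, ha', rfl⟩))
  by_cases hs : sub a
  · have h1 : (linkedWall n sub grey).Adj (mid a (Or.inr ha) hs) right :=
      linkedWall_adj_of_arc (.rightLinkOuter a ha hs)
    have h2 : (linkedWall n sub grey).Adj (wall a) (mid a (Or.inr ha) hs) :=
      linkedWall_adj_of_arc (.rightLinkInner a ha hs)
    have hmR : mid a (Or.inr ha) hs ∈ rightRegion n sub i j :=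
      Or.inr (Or.inr ⟨a, _, hs, ha, ha', rfl⟩)
    have hmr : mid a (Or.inr ha) hs ∈ rowSet n sub j :=
      Or.inr (Or.inr (Or.inr ⟨a, _, hs, ha', rfl⟩))
    exact .head ⟨h2, hrow _ _ har hmr h2, haR, hmR⟩
      (.single ⟨h1, hrow _ _ hmr (Or.inr (Or.inl rfl)) h1, hmR, Or.inl rfl⟩)
  · have h1 : (linkedWall n sub grey).Adj (wall a) right :=
      linkedWall_adj_of_arc (.rightLink a ha hs)
    exact .single ⟨h1, hrow _ _ har (Or.inr (Or.inl rfl)) h1, haR, Or.inl rfl⟩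

/-- Fewer than `r` edges of the linked wall with `10r × 10r` bricks leave two disjoint paths from
the `A`-vertices to two close vertices of the top row. -/
theorem exists_two_paths {r : ℕ} {sub : WallVertex (10 * r) → Prop}
    {Z : Finset (Sym2 (LinkedWallVertex (10 * r) sub))} (hZ : Z.card < r) {d : ℕ}
    (hd : d = 1 ∨ d = 2) :
    ∃ (v w : WallVertex (10 * r)) (p : (linkedWall (10 * r) sub grey).Walk left (wall v))
      (q : (linkedWall (10 * r) sub grey).Walk (wall w) right),
      v.row = 10 * r ∧ w.row = 10 * r ∧ v.col % 4 = 1 ∧ w.col = v.col + d ∧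
      ((linkedWall (10 * r) sub grey).Adj (wall v) (wall w) → s(wall v, wall w) ∉ Z) ∧
      p.IsPath ∧ q.IsPath ∧ (∀ x ∈ p.support, x ∉ q.support) ∧
      (∀ e ∈ p.edges, e ∉ Z) ∧ (∀ e ∈ q.edges, e ∉ Z) ∧
      (∀ x y, s(x, y) ∈ p.edges → ¬ IsGrey x y) ∧ (∀ x y, s(x, y) ∈ q.edges → ¬ IsGrey x y) := by
  obtain ⟨m, hm, hrow⟩ := exists_edgeFree_row (grey := grey) hZ
  obtain ⟨i, hi, hblock⟩ := exists_edgeFree_block (grey := grey) hZ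
  have hn : Even (10 * r) := by rw [Nat.even_iff]; omega
  have hj : Odd (2 * m + 1) := by rw [Nat.odd_iff]; omega
  have hjn : 2 * m + 1 < 10 * r := by omega
  -- Column `4 * i + 1` is the last one of the left half of the block. For `d = 1` the right half
  -- begins next to it; for `d = 2` the two vertices are the ends of a grey edge.
  obtain ⟨v, hv, hv'⟩ := WallVertex.exists_of_row_pos hn (x := 4 * i + 1) (y := 10 * r)
    (by omega) (by omega) (by omega) (Or.inl (by omega))
  obtain ⟨w, hw, hw'⟩ := WallVertex.exists_of_row_pos hn (x := 4 * i + 1 + d) (y := 10 * r)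
    (by omega) (by omega) (by omega) (Or.inl (by omega))
  obtain ⟨p, hp, hpR, hpZ⟩ := exists_isPath_of_avoidStep
    (R := leftRegion (10 * r) sub i (2 * m + 1)) (Or.inl rfl)
    (reflTransGen_leftRegion hn hj hjn (by omega) hrow hblock hv' hv)
  obtain ⟨q, hq, hqR, hqZ⟩ := exists_isPath_of_avoidStep
    (R := rightRegion (10 * r) sub i (2 * m + 1)) (Or.inr (Or.inl ⟨w, rfl, Or.inr (by omega)⟩))
    (reflTransGen_rightRegion hn hj hjn (by omega) hrow hblock hw' (by omega))
  refine ⟨v, w, p, q, hv', hw', by omega, by omega, ?_, hp, hq, ?_, hpZ, hqZ, ?_, ?_⟩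
  · exact hblock _ _ ⟨v, by omega, rfl⟩ ⟨w, by omega, rfl⟩
  · exact fun x hx hx' => leftRegion_disjoint_rightRegion x (hpR x hx) (hqR x hx')
  · exact fun x y h => not_isGrey_of_mem_leftRegion hjn
      (hpR x (p.fst_mem_support_of_mem_edges h)) (hpR y (p.snd_mem_support_of_mem_edges h))
  · exact fun x y h => not_isGrey_of_mem_rightRegion hjn
      (hqR x (q.fst_mem_support_of_mem_edges h)) (hqR y (q.snd_mem_support_of_mem_edges h))

end Avoiding

/-! ## Parity and labels of walks in the linked wall -/

section Labels

variable {n : ℕ}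

/-- A colouring of the linked wall by natural numbers modulo two; `ρ` is the colour of the right
`A`-vertex. -/
def LinkedWallVertex.color {sub : WallVertex n → Prop} (ρ : ℕ) : LinkedWallVertex n sub → ℕ
  | left => 1
  | right => ρ
  | wall v => v.col + v.row
  | mid v _ _ => v.col + v.row + 1

/-- The hypotheses on `sub` say exactly that the colouring is proper modulo two on the links; it is
proper on wall edges anyway. Only grey edges join vertices of equal colour. -/
theorem even_length_add_color {sub : WallVertex n → Prop} {grey : Prop} {ρ : ℕ}
    (hleft : ∀ v : WallVertex n, v.OnLeftSide → (sub v ↔ Odd (v.col + v.row)))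
    (hright : ∀ v : WallVertex n, v.OnRightSide → (sub v ↔ Odd (v.col + v.row + 1 + ρ)))
    {x y : LinkedWallVertex n sub} (p : (linkedWall n sub grey).Walk x y)
    (hp : ∀ a b, s(a, b) ∈ p.edges → ¬ IsGrey a b) : Even (p.length + x.color ρ + y.color ρ) := by
  have arc : ∀ a b : LinkedWallVertex n sub, LinkedWallArc n sub grey a b → ¬ IsGrey a b →
      Odd (a.color ρ + b.color ρ) := by
    intro a b h hg
    simp only [Nat.odd_iff] at hleft hright ⊢
    cases h with
    | horizontal v v' h => obtain ⟨h1, h2⟩ := h; simp only [color]; omega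
    | vertical v v' h => obtain ⟨h1, h2, h3⟩ := h; simp only [color]; omega
    | greyEdge v v' _ h => exact absurd ⟨v, v', h, rfl⟩ hg
    | leftLink v h hs => have := mt (hleft v h).2 hs; simp only [color]; omega
    | leftLinkOuter v h hs => have := (hleft v h).1 hs; simp only [color]; omega
    | leftLinkInner v h hs => simp only [color]; omega
    | rightLink v h hs => have := mt (hright v h).2 hs; simp only [color]; omega
    | rightLinkInner v h hs => simp only [color]; omega
    | rightLinkOuter v h hs => have := (hright v h).1 hs; simp only [color]; omega
  induction p with
  | nil => simp only [SimpleGraph.Walk.length_nil, Nat.even_iff]; omega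
  | @cons x y z h q ih =>
    have ih := ih fun a b hab => hp a b (by simp [hab])
    have hxy : ¬ IsGrey x y := hp x y (by simp)
    have hyx : ¬ IsGrey y x := fun ⟨v, v', h1, h2⟩ => hxy ⟨v, v', h1, Sym2.eq_swap.trans h2⟩
    have : Odd (x.color ρ + y.color ρ) := by
      rcases h.2 with h | h
      · exact arc x y h hxy
      · rw [add_comm]; exact arc y x h hyx
    rw [SimpleGraph.Walk.length_cons]
    rw [Nat.odd_iff] at this
    rw [Nat.even_iff] at ih ⊢
    omega

variable {Γ : Type w} [AddCommGroup Γ] (μ : Γ)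

theorem zeroWallLabel_left (x : LinkedWallVertex n (oddSub n)) :
    zeroWallLabel n μ s(left, x) = μ := by
  simp [zeroWallLabel]

theorem zeroWallLabel_grey {v v' : WallVertex n} (h : v.GreyPair v') :
    zeroWallLabel n μ s(wall v, wall v') = -μ := by
  rw [zeroWallLabel, if_neg (by simp), if_pos ⟨v, v', h, rfl⟩]

theorem zeroWallLabel_eq_zero {x y : LinkedWallVertex n (oddSub n)} (hx : x ≠ left) (hy : y ≠ left)
    (h : ¬ IsGrey x y) : zeroWallLabel n μ s(x, y) = 0 := by
  rw [zeroWallLabel, if_neg (by simp [hx.symm, hy.symm])]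
  exact if_neg h

theorem sum_zeroWallLabel_of_left_notMem {x y : LinkedWallVertex n (oddSub n)}
    (p : (oddWall n).Walk x y) (hp : ∀ a b, s(a, b) ∈ p.edges → ¬ IsGrey a b)
    (hl : left ∉ p.support) : (p.edges.map (zeroWallLabel n μ)).sum = 0 := by
  apply List.sum_eq_zero
  intro g hg
  obtain ⟨e, he, rfl⟩ := List.mem_map.1 hg
  induction e with
  | h a b =>
    refine zeroWallLabel_eq_zero μ ?_ ?_ (hp a b he)
    · rintro rfl; exact hl (p.fst_mem_support_of_mem_edges he)
    · rintro rfl; exact hl (p.snd_mem_support_of_mem_edges he)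

/-- A path leaves its first vertex once, so exactly one of its edges carries `μ`. -/
theorem sum_zeroWallLabel_of_left {y : LinkedWallVertex n (oddSub n)} (p : (oddWall n).Walk left y)
    (hpath : p.IsPath) (hy : left ≠ y) (hp : ∀ a b, s(a, b) ∈ p.edges → ¬ IsGrey a b) :
    (p.edges.map (zeroWallLabel n μ)).sum = μ := by
  cases p with
  | nil => exact absurd rfl hy
  | cons h q =>
    rw [SimpleGraph.Walk.cons_isPath_iff] at hpath
    rw [SimpleGraph.Walk.edges_cons, List.map_cons, List.sum_cons, zeroWallLabel_left,
      sum_zeroWallLabel_of_left_notMem μ q (fun a b hab => hp a b (by simp [hab])) hpath.2, add_zero]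

theorem sum_zeroWallLabel_of_right {x : LinkedWallVertex n (oddSub n)}
    (p : (oddWall n).Walk x left) (hpath : p.IsPath) (hx : x ≠ left)
    (hp : ∀ a b, s(a, b) ∈ p.edges → ¬ IsGrey a b) :
    (p.edges.map (zeroWallLabel n μ)).sum = μ := by
  have := sum_zeroWallLabel_of_left μ p.reverse hpath.reverse hx.symm (by simpa using hp)
  rwa [SimpleGraph.Walk.edges_reverse, List.map_reverse, List.sum_reverse] at this

theorem sum_zeroWallLabel_append {v w : WallVertex n} {y : LinkedWallVertex n (oddSub n)}
    (p : (oddWall n).Walk left (wall v)) (q : (oddWall n).Walk (wall w) y)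
    (h : (oddWall n).Adj (wall v) (wall w)) (hvw : v.GreyPair w) (hpath : p.IsPath)
    (hq : left ∉ q.support) (hpg : ∀ a b, s(a, b) ∈ p.edges → ¬ IsGrey a b)
    (hqg : ∀ a b, s(a, b) ∈ q.edges → ¬ IsGrey a b) :
    ((p.append (.cons h q)).edges.map (zeroWallLabel n μ)).sum = 0 := by
  rw [SimpleGraph.Walk.edges_append, SimpleGraph.Walk.edges_cons, List.map_append, List.map_cons,
    List.sum_append, List.sum_cons, zeroWallLabel_grey μ hvw,
    sum_zeroWallLabel_of_left μ p hpath (by simp) hpg,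
    sum_zeroWallLabel_of_left_notMem μ q hqg hq]
  simp

-- Off the grey edges, the weights are differences of the potential that is `μ` at `left` and `0`
-- elsewhere, so the sum telescopes. This uses that all edges at `left` are oriented away from it.
open Classical in
theorem sum_weight_zeroWall {x y : LinkedWallVertex n (oddSub n)} (p : (oddWall n).Walk x y)
    (hp : ∀ a b, s(a, b) ∈ p.edges → ¬ IsGrey a b) :
    (p.darts.map (zeroWallDirectedLabelling n μ).weight).sum =
      (if x = left then μ else 0) - (if y = left then μ else 0) := by
  induction p with
  | nil => simp
  | @cons x y z h q ih =>
    have hxy : ¬ IsGrey x y := hp x y (by simp)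
    rw [SimpleGraph.Walk.darts_cons, List.map_cons, List.sum_cons,
      ih fun a b hab => hp a b (by simp [hab])]
    suffices (zeroWallDirectedLabelling n μ).weight ⟨(x, y), h⟩ =
        (if x = left then μ else 0) - (if y = left then μ else 0) by
      rw [this, sub_add_sub_cancel]
    have hne : x ≠ y := h.ne
    change (if LinkedWallArc n (oddSub n) True x y then zeroWallLabel n μ s(x, y)
      else - zeroWallLabel n μ s(x, y)) = _
    by_cases hx : x = left
    · subst hx
      have harc : LinkedWallArc n (oddSub n) True left y :=
        h.2.resolve_right fun h => by cases h
      rw [if_pos harc, if_pos rfl, if_neg hne.symm, zeroWallLabel_left, sub_zero]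
    · by_cases hy : y = left
      · subst hy
        rw [if_neg (fun h => by cases h), if_neg hx, if_pos rfl, Sym2.eq_swap, zeroWallLabel_left,
          zero_sub]
      · rw [if_neg hx, if_neg hy, zeroWallLabel_eq_zero μ hx hy hxy]
        simp

theorem sum_weight_zeroWall_append {v w : WallVertex n}
    (p : (oddWall n).Walk left (wall v)) (q : (oddWall n).Walk (wall w) right)
    (h : (oddWall n).Adj (wall v) (wall w)) (hvw : v.GreyPair w)
    (hpg : ∀ a b, s(a, b) ∈ p.edges → ¬ IsGrey a b)
    (hqg : ∀ a b, s(a, b) ∈ q.edges → ¬ IsGrey a b) :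
    ((p.append (.cons h q)).darts.map (zeroWallDirectedLabelling n μ).weight).sum = 0 := by
  have hw : (zeroWallDirectedLabelling n μ).weight ⟨(wall v, wall w), h⟩ = -μ := by
    have harc : (zeroWallDirectedLabelling n μ).dir (wall v) (wall w) :=
      .greyEdge v w trivial hvw
    exact (if_pos harc).trans (zeroWallLabel_grey μ hvw)
  rw [SimpleGraph.Walk.darts_append, SimpleGraph.Walk.darts_cons, List.map_append, List.map_cons,
    List.sum_append, List.sum_cons, hw, sum_weight_zeroWall μ p hpg, sum_weight_zeroWall μ q hqg]
  simp

end Labels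

/-! ## The counterexamples -/

section Counterexamples

theorem isAPath_linkedWallA {n : ℕ} {sub : WallVertex n → Prop} {grey : Prop}
    {p : (linkedWall n sub grey).Walk left right} (hp : p.IsPath) :
    IsAPath (linkedWallA n sub) p :=
  ⟨hp, by simp, Or.inl rfl, Or.inr rfl, fun _ _ h => h⟩

theorem exists_top_of_isGrey {n : ℕ} {sub : WallVertex n → Prop} {grey : Prop}
    {s t : LinkedWallVertex n sub} {p : (linkedWall n sub grey).Walk s t}
    (h : ¬ ∀ x y, s(x, y) ∈ p.edges → ¬ IsGrey x y) :
    ∃ v : WallVertex n, v.OnTop ∧ wall v ∈ p.support := by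
  push Not at h
  obtain ⟨x, y, he, v, v', hv, hxy⟩ := h
  exact ⟨v, hv.1, p.fst_mem_support_of_mem_edges (hxy ▸ he)⟩

/-- If all target paths of the linked wall are `A`-paths that meet the top row, and every path that
runs from the left `A`-vertex to the top row, uses there one edge of the given kind, and proceeds to
the right `A`-vertex is a target path, then the linked wall is a counterexample. -/
theorem isEdgeCounterexample_linkedWall {r : ℕ} {sub : WallVertex (10 * r) → Prop} {grey : Prop}
    {T : ∀ ⦃s t : LinkedWallVertex (10 * r) sub⦄, (linkedWall (10 * r) sub grey).Walk s t → Prop}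
    (htop : ∀ ⦃s t⦄ (p : (linkedWall (10 * r) sub grey).Walk s t), T p →
      IsAPath (linkedWallA (10 * r) sub) p ∧
        ∃ v : WallVertex (10 * r), v.OnTop ∧ wall v ∈ p.support)
    {d : ℕ} (hd : d = 1 ∨ d = 2)
    (hadj : ∀ v w : WallVertex (10 * r), v.row = 10 * r → w.row = 10 * r → v.col % 4 = 1 →
      w.col = v.col + d → LinkedWallArc (10 * r) sub grey (wall v) (wall w))
    (hT : ∀ (v w : WallVertex (10 * r)) (p : (linkedWall (10 * r) sub grey).Walk left (wall v))
      (q : (linkedWall (10 * r) sub grey).Walk (wall w) right)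
      (h : (linkedWall (10 * r) sub grey).Adj (wall v) (wall w)),
      v.row = 10 * r → w.row = 10 * r → v.col % 4 = 1 → w.col = v.col + d →
      p.IsPath → left ∉ q.support →
      (∀ x y, s(x, y) ∈ p.edges → ¬ IsGrey x y) → (∀ x y, s(x, y) ∈ q.edges → ¬ IsGrey x y) →
      IsAPath (linkedWallA (10 * r) sub) (p.append (.cons h q)) → T (p.append (.cons h q))) :
    IsEdgeCounterexample T r := by
  refine ⟨not_hasEdgeDisjoint_two (by rw [Nat.even_iff]; omega) htop, fun Z hZ => ?_⟩
  by_contra! hlt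
  obtain ⟨v, w, p, q, hv, hw, hc, hvw, hvwZ, hp, hq, hpq, hpZ, hqZ, hpg, hqg⟩ :=
    exists_two_paths (grey := grey) hlt hd
  have h := linkedWall_adj_of_arc (hadj v w hv hw hc hvw)
  obtain ⟨e, he, heZ⟩ := hZ.2 _ (hT v w p q h hv hw hc hvw hp (hpq _ p.start_mem_support) hpg hqg
    (isAPath_linkedWallA (hp.append_cons hq h hpq)))
  rw [SimpleGraph.Walk.edges_append, SimpleGraph.Walk.edges_cons, List.mem_append,
    List.mem_cons] at he
  rcases he with he | rfl | he
  exacts [hpZ e he heZ, hvwZ h heZ, hqZ e he heZ]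

theorem isEdgeCounterexample_abaWall (r : ℕ) :
    IsEdgeCounterexample (G := abaWall (10 * r))
      (fun _ _ p => IsABAPath (linkedWallA (10 * r) _) (linkedWallB (10 * r) _) p) r := by
  refine isEdgeCounterexample_linkedWall (grey := False) ?_ (d := 1) (Or.inl rfl) ?_ ?_
  · rintro s t p ⟨hp, x, hx, v, hv, rfl⟩
    exact ⟨hp, v, hv, hx⟩
  · intro v w hv hw _ hvw
    exact .horizontal v w ⟨hv.trans hw.symm, hvw.symm⟩
  · intro v w p q h hv hw _ _ _ _ _ _ hA
    have hmem : wall v ∈ (p.append (.cons h q)).support := by simp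
    exact ⟨hA, wall v, hmem, v, hv, rfl⟩

/-- In a linked wall with grey edges, paths whose parity differs from the parity of the paths
without grey edges form a counterexample. -/
theorem isEdgeCounterexample_parity {r : ℕ} {sub : WallVertex (10 * r) → Prop} {ρ : ℕ}
    (hleft : ∀ v : WallVertex (10 * r), v.OnLeftSide → (sub v ↔ Odd (v.col + v.row)))
    (hright : ∀ v : WallVertex (10 * r), v.OnRightSide → (sub v ↔ Odd (v.col + v.row + 1 + ρ))) :
    IsEdgeCounterexample (G := linkedWall (10 * r) sub True)
      (fun _ _ p => IsAPath (linkedWallA (10 * r) _) p ∧ Even (p.length + ρ)) r := by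
  refine isEdgeCounterexample_linkedWall ?_ (d := 2) (Or.inr rfl) ?_ ?_
  · rintro s t p ⟨hp, hpar⟩
    refine ⟨hp, exists_top_of_isGrey fun h => ?_⟩
    -- The ends of an `A`-path have colours `1` and `ρ`, so without grey edges its length has the
    -- parity of `1 + ρ`.
    have := even_length_add_color hleft hright p h
    obtain ⟨-, hst, rfl | rfl, rfl | rfl, -⟩ := hp
    · exact hst rfl
    · simp only [color, Nat.even_iff] at *; omega
    · simp only [color, Nat.even_iff] at *; omega
    · exact hst rfl
  · intro v w hv hw hc hvw
    exact .greyEdge v w trivial ⟨hv, hw, hc, hvw⟩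
  · intro v w p q h hv hw _ hvw _ _ hpg hqg hA
    refine ⟨hA, ?_⟩
    -- The grey edge joins equal colours modulo two, so using exactly one of them flips the parity.
    have h1 := even_length_add_color hleft hright p hpg
    have h2 := even_length_add_color hleft hright q hqg
    rw [SimpleGraph.Walk.length_append, SimpleGraph.Walk.length_cons]
    simp only [color, Nat.even_iff] at *
    omega

theorem isEdgeCounterexample_evenWall (r : ℕ) :
    IsEdgeCounterexample (G := evenWall (10 * r))
      (fun _ _ p => IsEvenAPath (linkedWallA (10 * r) _) p) r := by
  refine isEdgeCounterexample_parity (sub := evenSub (10 * r)) (ρ := 0) ?_ ?_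
  · intro v hv
    simp only [evenSub, WallVertex.OnLeftSide, WallVertex.OnRightSide, Nat.odd_iff,
      Nat.even_iff] at *
    omega
  · intro v hv
    simp only [evenSub, WallVertex.OnLeftSide, WallVertex.OnRightSide, Nat.odd_iff,
      Nat.even_iff] at *
    omega

theorem isEdgeCounterexample_oddWall (r : ℕ) :
    IsEdgeCounterexample (G := oddWall (10 * r))
      (fun _ _ p => IsOddAPath (linkedWallA (10 * r) _) p) r := by
  have h := isEdgeCounterexample_parity (r := r) (sub := oddSub (10 * r)) (ρ := 1)
    (fun v _ => Iff.rfl) (fun v _ => by simp only [oddSub, Nat.odd_iff]; omega)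
  simp only [Nat.even_add_one, Nat.not_even_iff_odd] at h
  exact h

variable {Γ : Type w} [AddCommGroup Γ] {μ : Γ}

theorem isEdgeCounterexample_undirectedZero (r : ℕ) (hμ : μ ≠ 0) :
    IsEdgeCounterexample (G := oddWall (10 * r))
      (fun _ _ p => IsUndirectedZeroAPath (linkedWallA (10 * r) _)
        (zeroWallLabel (10 * r) μ) p) r := by
  refine isEdgeCounterexample_linkedWall (grey := True) ?_ (d := 2) (Or.inr rfl) ?_ ?_
  · rintro s t p ⟨hp, hzero⟩
    refine ⟨hp, exists_top_of_isGrey fun h => hμ ?_⟩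
    obtain ⟨hpath, hst, rfl | rfl, rfl | rfl, -⟩ := hp
    · exact absurd rfl hst
    · rw [← hzero, sum_zeroWallLabel_of_left μ p hpath hst h]
    · rw [← hzero, sum_zeroWallLabel_of_right μ p hpath hst h]
    · exact absurd rfl hst
  · intro v w hv hw hc hvw
    exact .greyEdge v w trivial ⟨hv, hw, hc, hvw⟩
  · intro v w p q h hv hw hc hvw hp hq hpg hqg hA
    exact ⟨hA, sum_zeroWallLabel_append μ p q h ⟨hv, hw, hc, hvw⟩ hp hq hpg hqg⟩

theorem isEdgeCounterexample_directedZero (r : ℕ) (hμ : μ ≠ 0) :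
    IsEdgeCounterexample (G := oddWall (10 * r))
      (fun _ _ p => IsDirectedZeroAPath (linkedWallA (10 * r) _)
        (zeroWallDirectedLabelling (10 * r) μ) p) r := by
  refine isEdgeCounterexample_linkedWall (grey := True) ?_ (d := 2) (Or.inr rfl) ?_ ?_
  · rintro s t p ⟨hp, hzero⟩
    refine ⟨hp, exists_top_of_isGrey fun h => hμ ?_⟩
    have := sum_weight_zeroWall μ p h
    rw [hzero] at this
    obtain ⟨hpath, hst, rfl | rfl, rfl | rfl, -⟩ := hp
    · exact absurd rfl hst
    · simpa using this.symm
    · simpa using this.symm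
    · exact absurd rfl hst
  · intro v w hv hw hc hvw
    exact .greyEdge v w trivial ⟨hv, hw, hc, hvw⟩
  · intro v w p q h hv hw hc hvw hp hq hpg hqg hA
    exact ⟨hA, sum_weight_zeroWall_append μ p q h ⟨hv, hw, hc, hvw⟩ hpg hqg⟩

end Counterexamples

/-! ## Failure of the edge-Erdős--Pósa property -/

instance (n : ℕ) : Finite (WallVertex n) :=
  Finite.of_injective (β := Fin (2 * n + 2) × Fin (n + 1))
    (fun v => (⟨v.col, Nat.lt_succ_of_le v.2.1⟩, ⟨v.row, Nat.lt_succ_of_le v.2.2.1⟩))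
    fun v w h => by
      simp only [Prod.mk.injEq, Fin.mk.injEq] at h
      exact WallVertex.ext h.1 h.2

instance (n : ℕ) (sub : WallVertex n → Prop) : Finite (LinkedWallVertex n sub) :=
  Finite.of_injective (β := Fin 4 × Option (WallVertex n))
    (fun x => match x with
      | left => (0, none)
      | right => (1, none)
      | wall v => (2, some v)
      | mid v _ _ => (3, some v))
    fun x y h => by cases x <;> cases y <;> simp_all

theorem not_hasEdgeErdosPosaProperty {S : ∀ V : Type, SimpleGraph V → Type w}
    {T : ∀ {V : Type} (G : SimpleGraph V), S V G → ∀ ⦃s t : V⦄, G.Walk s t → Prop}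
    (V : ℕ → Type) [∀ r, Finite (V r)] (G : ∀ r, SimpleGraph (V r)) (σ : ∀ r, S (V r) (G r))
    (h : ∀ r, IsEdgeCounterexample (T (G r) (σ r)) r) : ¬ HasEdgeErdosPosaProperty S T := by
  rintro ⟨f, hf⟩
  -- Already `k = 2` fails: no bound `f 2` suffices for the counterexample with `r = f 2 + 1`.
  rcases hf 2 (V (f 2 + 1)) (G _) (σ _) with hd | ⟨Z, hZ, hhit⟩
  · exact (h _).1 hd
  · have := (h _).2 Z hhit
    omega

theorem mainTheorem4 :
    -- none of the classes has the edge-Erdős--Pósa property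
    (¬ ABAPathsEdgeErdosPosa ∧ ¬ EvenAPathsEdgeErdosPosa ∧ ¬ OddAPathsEdgeErdosPosa ∧
      ∀ (Γ : Type u) [AddCommGroup Γ] [Nontrivial Γ],
        ¬ UndirectedZeroAPathsEdgeErdosPosa Γ ∧ ¬ DirectedZeroAPathsEdgeErdosPosa Γ) ∧
    -- the walls with `10r × 10r` bricks are counterexamples
    ∀ r : ℕ, 1 ≤ r →
      IsEdgeCounterexample (G := abaWall (10 * r))
        (fun _ _ p => IsABAPath (linkedWallA (10 * r) _) (linkedWallB (10 * r) _) p) r ∧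
      IsEdgeCounterexample (G := evenWall (10 * r))
        (fun _ _ p => IsEvenAPath (linkedWallA (10 * r) _) p) r ∧
      IsEdgeCounterexample (G := oddWall (10 * r))
        (fun _ _ p => IsOddAPath (linkedWallA (10 * r) _) p) r ∧
      ∀ (Γ : Type u) [AddCommGroup Γ] (μ : Γ), μ ≠ 0 →
        IsEdgeCounterexample (G := oddWall (10 * r))
          (fun _ _ p => IsUndirectedZeroAPath (linkedWallA (10 * r) _)
            (zeroWallLabel (10 * r) μ) p) r ∧
        IsEdgeCounterexample (G := oddWall (10 * r))
          (fun _ _ p => IsDirectedZeroAPath (linkedWallA (10 * r) _)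
            (zeroWallDirectedLabelling (10 * r) μ) p) r := by
  refine ⟨⟨?_, ?_, ?_, fun Γ _ _ => ?_⟩, fun r _ => ⟨isEdgeCounterexample_abaWall r,
    isEdgeCounterexample_evenWall r, isEdgeCounterexample_oddWall r, fun Γ _ μ hμ =>
    ⟨isEdgeCounterexample_undirectedZero r hμ, isEdgeCounterexample_directedZero r hμ⟩⟩⟩
  · exact not_hasEdgeErdosPosaProperty _ (fun r => abaWall (10 * r))
      (fun r => (linkedWallA (10 * r) _, linkedWallB (10 * r) _)) isEdgeCounterexample_abaWall
  · exact not_hasEdgeErdosPosaProperty _ (fun r => evenWall (10 * r))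
      (fun r => linkedWallA (10 * r) _) isEdgeCounterexample_evenWall
  · exact not_hasEdgeErdosPosaProperty _ (fun r => oddWall (10 * r))
      (fun r => linkedWallA (10 * r) _) isEdgeCounterexample_oddWall
  · obtain ⟨μ, hμ⟩ := exists_ne (0 : Γ)
    exact ⟨not_hasEdgeErdosPosaProperty _ (fun r => oddWall (10 * r))
      (fun r => (linkedWallA (10 * r) _, zeroWallLabel (10 * r) μ))
      fun r => isEdgeCounterexample_undirectedZero r hμ,
      not_hasEdgeErdosPosaProperty _ (fun r => oddWall (10 * r))
      (fun r => (linkedWallA (10 * r) _, zeroWallDirectedLabelling (10 * r) μ))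
      fun r => isEdgeCounterexample_directedZero r hμ⟩
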